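/- For $c\in\mathbf R$, call *orbit issuing from* $(c,0,\pi/2)$ a solution $\tilde\alpha_c=(\tilde z,\tilde r,\theta)$, continuous on an interval $[0,T]$ with $T>0$ and with $\tilde r>0$ on $(0,T]$, of $$\dot{\tilde z}=\cos\theta,\qquad \dot{\tilde r}=\sin\theta,\qquad \dot\theta=\tilde z\sin\theta+\Big(\frac1{\tilde r}-\tilde r\Big)\cos\theta \qquad (0<t<T)$$ with $\tilde z(0)=c$, $\tilde r(0)=0$, $\theta(0)=\pi/2$. We say that $\tilde\alpha_c$ *hits the line $\tilde z=w$ at an angle $\vartheta$* if for some $T>0$ an orbit issuing from $(c,0,\pi/2)$ is defined on $[0,T]$ and satisfies $\tilde z\ge 0$ on $[0,T]$, $\tilde z(T)=w$ and $\theta(T)=\vartheta$. **Corollary.** There are constants $\delta_c,\delta_\theta,C>0$ with the following properties. (i) For every $c\in(\sqrt2-\delta_c,\sqrt2+\delta_c)$ the orbit $\tilde\alpha_c$ is well defined until it leaves the first quadrant: there is an orbit issuing from $(c,0,\pi/2)$ on some $[0,T]$ with $\tilde z>0$ on $[0,T)$ and $\tilde z(T)=0$, and any two orbits issuing from $(c,0,\pi/2)$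 agree on their common interval of definition. (ii) For every $a>0$ there is $\tau_0>0$ such that for every $\tau\in(0,\tau_0)$ and every $\theta_1\in\mathbf R$ with $$\big|\theta_1-(\pi-\sin^{-1}(\tau a/\sqrt2))\big|\le\delta_\theta$$ there is a unique $c_1\in(\sqrt2-\delta_c,\sqrt2+\delta_c)$ for which the orbit $\tilde\alpha_{c_1}$ hits the line $\tilde z=\tau a$ at the angle $\theta_1$; moreover $$|c_1-\sqrt2|\le C\,\big|\theta_1-\pi+\sin^{-1}(\tau a/\sqrt2)\big|.$$ In particular $\delta_c$, $\delta_\theta$ and $C$ do not depend on $\tau$. -/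

import Mathlib

/-- `(z, r, θ)` is an orbit on `[0, T]` of the profile-curve system of rotationally symmetric
self-shrinkers
  `z' = cos θ`, `r' = sin θ`, `θ' = z sin θ + (1 / r - r) cos θ`
issuing from the point `(c, 0, π / 2)` of the axis of rotation. The system is singular at `r = 0`:
the equations hold at positive times, where `r > 0`, and the initial condition is taken by
continuity. -/
structure IsCapOrbit (c T : ℝ) (z r θ : ℝ → ℝ) : Prop where
  T_pos : 0 < T
  continuousOn_z : ContinuousOn z (Set.Icc 0 T)
  continuousOn_r : ContinuousOn r (Set.Icc 0 T)
  continuousOn_θ : ContinuousOn θ (Set.Icc 0 T)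
  z_zero : z 0 = c
  r_zero : r 0 = 0
  θ_zero : θ 0 = Real.pi / 2
  r_pos : ∀ t ∈ Set.Ioc 0 T, 0 < r t
  deriv_z : ∀ t ∈ Set.Ioo 0 T, HasDerivAt z (Real.cos (θ t)) t
  deriv_r : ∀ t ∈ Set.Ioo 0 T, HasDerivAt r (Real.sin (θ t)) t
  deriv_θ : ∀ t ∈ Set.Ioo 0 T,
    HasDerivAt θ (z t * Real.sin (θ t) + (1 / r t - r t) * Real.cos (θ t)) t

/-- An orbit issuing from `(c, 0, π / 2)` reaches the line `z = w` at some time `T` with tangent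
angle `ϑ`, having stayed in the closed first quadrant of the `zr`-plane up to that time
(`r ≥ 0` is part of `IsCapOrbit`). -/
def OrbitHitsLine (c w ϑ : ℝ) : Prop :=
  ∃ (T : ℝ) (z r θ : ℝ → ℝ), IsCapOrbit c T z r θ ∧
    (∀ t ∈ Set.Icc 0 T, 0 ≤ z t) ∧ z T = w ∧ θ T = ϑ

/-- The orbit issuing from `(c, 0, π / 2)` exists until it leaves the first quadrant of the
`zr`-plane through the `r`-axis, and any two orbits issuing from that point agree as long as both
exist. -/
def OrbitWellDefined (c : ℝ) : Prop :=
  (∃ (T : ℝ) (z r θ : ℝ → ℝ), IsCapOrbit c T z r θ ∧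
    (∀ t ∈ Set.Ico 0 T, 0 < z t) ∧ z T = 0) ∧
  ∀ (T T' : ℝ) (z r θ z' r' θ' : ℝ → ℝ), IsCapOrbit c T z r θ → IsCapOrbit c T' z' r' θ' →
    ∀ t ∈ Set.Icc 0 (min T T'), z t = z' t ∧ r t = r' t ∧ θ t = θ' t

/-! The sphere of radius `√2` is the orbit with `c = √2`. Nearby profile curves are graphs `ρ = √2 *
exp (f φ)` in polar coordinates of the `zr`-plane. With `σ` the sine of the angle between the curve
and the circles about the origin, the system becomes `f' = -σ / √(1 - σ²)`, `σ' = 2 √(1 - σ²) (exp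
(2 f) - 1) - cot φ * σ`, whose only singular term is linear. Inverting `u ↦ u' + cot φ * u` by an
average turns this into a fixed point problem without singularity, and a contraction yields
solutions on `[0, π / 2]` that are Lipschitz in `y = log (c / √2)` (`exists_polarSolution_family`).

The crux is nondegeneracy at the equator. The linearization is `F' = -S`, `S' = 4 F - cot φ * S`,
that is, the Legendre-type equation `F'' + cot φ * F' + 4 F = 0`, and `S` must not vanish up to `π /
2`. Instead of evaluating a Legendre function, one compares, in the manner of Sturm, with an
explicit polynomial barrier built for the constant `4.1` in place of `4`. The margin leaves room for
small errors in the coefficients, so the comparison applies directly to the difference of two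
nonlinear solutions and shows that `σ` near the equator increases with `y` at a definite rate
(`exp_mul_le_of_barrier`, `exists_slope_lower_bound`).

The line `z = w` is met at a polar angle `φ` that varies with `y` only at rate `O(w)`
(`IsPolarProfile.abs_polarAngle_sub_le`). Hence, for small `w`, the arrival angle `φ + π / 2 +
arcsin σ` is increasing in `c`, with slopes between positive constants independent of `w`
(`exists_arrival_angle`), and the intermediate value theorem concludes. Uniqueness of orbits,
including at the singular starting point (`IsCapOrbit.eqOn`), ensures that every orbit is one of
those constructed. -/

open Set Filter Topology

/-! ### The singular polar system: existence and Lipschitz dependence -/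

/-- The average of `w` over `[0, φ]` against the weight `sin s / sin φ`; it inverts
`u ↦ u' + cot φ * u`. -/
noncomputable def sinAverage (w : ℝ → ℝ) (φ : ℝ) : ℝ :=
  (∫ s in (0 : ℝ)..φ, Real.sin s * w s) / Real.sin φ

/-- On `[0, π / 2]` the sine is increasing, so the weight `sin s / sin φ` is at most `1`. The
average is thus bounded like an ordinary primitive, which makes the singular component as tame as
the regular one. -/
lemma abs_sinAverage_le {w g : ℝ → ℝ} (hg : Continuous g) {φ : ℝ}
    (h0 : 0 ≤ φ) (h1 : φ ≤ Real.pi / 2) (hwg : ∀ s ∈ Icc 0 φ, |w s| ≤ g s) :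
    |sinAverage w φ| ≤ ∫ s in (0 : ℝ)..φ, g s := by
  rcases h0.eq_or_lt with rfl | h0
  · simp [sinAverage]
  have hsin : 0 < Real.sin φ := Real.sin_pos_of_pos_of_lt_pi h0 (by linarith [Real.pi_pos])
  rw [sinAverage, abs_div, abs_of_pos hsin, div_le_iff₀ hsin]
  have hb : |∫ s in (0 : ℝ)..φ, Real.sin s * w s| ≤ ∫ s in (0 : ℝ)..φ, g s * Real.sin φ := by
    rw [← Real.norm_eq_abs]
    apply intervalIntegral.norm_integral_le_of_norm_le h0.le
    · refine MeasureTheory.ae_of_all _ fun s hs => ?_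
      have hs0 : 0 ≤ Real.sin s :=
        Real.sin_nonneg_of_nonneg_of_le_pi hs.1.le (by linarith [hs.2, Real.pi_pos])
      have hsl : Real.sin s ≤ Real.sin φ :=
        Real.sin_le_sin_of_le_of_le_pi_div_two (by linarith [hs.1, Real.pi_pos]) h1 hs.2
      rw [Real.norm_eq_abs, abs_mul, abs_of_nonneg hs0, mul_comm]
      exact mul_le_mul (hwg s ⟨hs.1.le, hs.2⟩) hsl hs0
        ((abs_nonneg _).trans (hwg s ⟨hs.1.le, hs.2⟩))
    · exact (hg.mul continuous_const).intervalIntegrable _ _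
  simpa using hb

lemma sinAverage_sub {w w' : ℝ → ℝ} (hw : Continuous w) (hw' : Continuous w') (φ : ℝ) :
    sinAverage w φ - sinAverage w' φ = sinAverage (fun s => w s - w' s) φ := by
  rw [sinAverage, sinAverage, sinAverage, ← sub_div, ← intervalIntegral.integral_sub]
  · simp only [mul_sub]
  · exact (Real.continuous_sin.mul hw).intervalIntegrable _ _
  · exact (Real.continuous_sin.mul hw').intervalIntegrable _ _

lemma continuousOn_sinAverage {w : ℝ → ℝ} (hw : Continuous w) :
    ContinuousOn (sinAverage w) (Icc 0 (Real.pi / 2)) := by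
  intro φ hφ
  rcases hφ.1.eq_or_lt with rfl | h0
  -- At `φ = 0` the quotient is `0 / 0`, whose conventional value `0` is also the limit.
  · have hval : sinAverage w 0 = 0 := by simp [sinAverage]
    rw [ContinuousWithinAt, hval]
    have hlim : Tendsto (fun φ => ∫ s in (0 : ℝ)..φ, |w s|) (𝓝[Icc 0 (Real.pi / 2)] 0) (𝓝 0) := by
      have hc : Continuous fun φ => ∫ s in (0 : ℝ)..φ, |w s| :=
        intervalIntegral.continuous_primitive (fun a b => hw.abs.intervalIntegrable a b) 0
      simpa using (hc.tendsto 0).mono_left nhdsWithin_le_nhds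
    apply squeeze_zero_norm' _ hlim
    filter_upwards [self_mem_nhdsWithin] with φ hφ
    exact abs_sinAverage_le hw.abs hφ.1 hφ.2 fun _ _ => le_rfl
  · have hsin : 0 < Real.sin φ :=
      Real.sin_pos_of_pos_of_lt_pi h0 (by linarith [Real.pi_pos, hφ.2])
    apply ContinuousAt.continuousWithinAt
    have hc : Continuous fun φ => ∫ s in (0 : ℝ)..φ, Real.sin s * w s :=
      intervalIntegral.continuous_primitive
        (fun a b => (Real.continuous_sin.mul hw).intervalIntegrable a b) 0
    exact hc.continuousAt.div Real.continuous_sin.continuousAt hsin.ne'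

lemma hasDerivAt_sinAverage {w : ℝ → ℝ} (hw : Continuous w) {φ : ℝ} (h : Real.sin φ ≠ 0) :
    HasDerivAt (sinAverage w) (w φ - Real.cos φ / Real.sin φ * sinAverage w φ) φ := by
  have hc : Continuous fun s => Real.sin s * w s := Real.continuous_sin.mul hw
  have h1 : HasDerivAt (fun φ => ∫ s in (0 : ℝ)..φ, Real.sin s * w s) (Real.sin φ * w φ) φ :=
    intervalIntegral.integral_hasDerivAt_right (hc.intervalIntegrable _ _)
      (hc.stronglyMeasurableAtFilter _ _) hc.continuousAt
  refine (h1.div (Real.hasDerivAt_sin φ) h).congr_deriv ?_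
  rw [sinAverage]
  field_simp

/-- A solution on `[0, π / 2]` of `f' = V₁ (f, σ)`, `σ' = V₂ (f, σ) - cot φ * σ` with `f 0 = y` and
`σ 0 = 0`, in integral form. -/
structure IsPolarSolution (V : ℝ × ℝ → ℝ × ℝ) (y : ℝ) (x : ℝ → ℝ × ℝ) : Prop where
  continuous : Continuous x
  fst_eq : ∀ φ ∈ Icc 0 (Real.pi / 2), (x φ).1 = y + ∫ s in (0 : ℝ)..φ, (V (x s)).1
  snd_eq : ∀ φ ∈ Icc 0 (Real.pi / 2), (x φ).2 = sinAverage (fun s => (V (x s)).2) φ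

/-- The gain `1 / lam` of integration in an exponentially weighted norm; it makes the integral
operator contract on the whole interval, whatever the Lipschitz constant. -/
lemma exp_weight_integral_le {a lam φ : ℝ} (ha : 0 ≤ a) (hl : 0 < lam) :
    Real.exp (-(lam * φ)) * ∫ s in (0 : ℝ)..φ, a * Real.exp (lam * s) ≤ a / lam := by
  have h : ∫ s in (0 : ℝ)..φ, a * Real.exp (lam * s) = a / lam * (Real.exp (lam * φ) - 1) := by
    rw [intervalIntegral.integral_const_mul, intervalIntegral.integral_comp_mul_left _ hl.ne']
    simp
    field_simp
  rw [h]
  have h2 : Real.exp (-(lam * φ)) * Real.exp (lam * φ) = 1 := by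
    rw [← Real.exp_add]; simp
  have h3 : 0 ≤ a / lam := by positivity
  have h4 := Real.exp_pos (-(lam * φ))
  nlinarith [mul_nonneg h3 h4.le]

section PolarOperator

variable (V : ℝ × ℝ → ℝ × ℝ) (lam : ℝ)

/-- The extension to the line of a function on `[0, π / 2]`, times `exp (lam * s)`. -/
noncomputable def unweight (x : C(Icc (0 : ℝ) (Real.pi / 2), ℝ × ℝ)) (s : ℝ) : ℝ × ℝ :=
  Real.exp (lam * s) • IccExtend (by positivity) x s

lemma continuous_unweight (x : C(Icc (0 : ℝ) (Real.pi / 2), ℝ × ℝ)) :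
    Continuous (unweight lam x) := by
  unfold unweight
  have : Continuous (IccExtend (by positivity : (0 : ℝ) ≤ Real.pi / 2) x) :=
    x.continuous.Icc_extend'
  fun_prop

lemma norm_unweight_sub_le (x x' : C(Icc (0 : ℝ) (Real.pi / 2), ℝ × ℝ)) (s : ℝ) :
    ‖unweight lam x s - unweight lam x' s‖ ≤ Real.exp (lam * s) * ‖x - x'‖ := by
  rw [unweight, unweight, ← smul_sub, norm_smul, Real.norm_eq_abs, Real.abs_exp]
  gcongr
  exact (x - x').norm_coe_le_norm _

variable {V} (hV : Continuous V)

/-- The integral operator whose fixed points are the weighted solutions. -/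
noncomputable def polarOperator (y : ℝ) (x : C(Icc (0 : ℝ) (Real.pi / 2), ℝ × ℝ)) :
    C(Icc (0 : ℝ) (Real.pi / 2), ℝ × ℝ) where
  toFun φ := Real.exp (-(lam * φ)) •
    (y + ∫ s in (0 : ℝ)..φ, (V (unweight lam x s)).1,
      sinAverage (fun s => (V (unweight lam x s)).2) φ)
  continuous_toFun := by
    have hc := hV.comp (continuous_unweight lam x)
    have h1 : Continuous fun φ => ∫ s in (0 : ℝ)..φ, (V (unweight lam x s)).1 :=
      intervalIntegral.continuous_primitive (fun a b => hc.fst.intervalIntegrable a b) 0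
    have h2 := continuousOn_iff_continuous_domRestrict.1 (continuousOn_sinAverage hc.snd)
    have h3 : Continuous fun φ : Icc (0 : ℝ) (Real.pi / 2) =>
      sinAverage (fun s => (V (unweight lam x s)).2) φ := h2
    fun_prop

lemma norm_polarOperator_sub_le (hl : 0 < lam) {K : NNReal} (hK : LipschitzWith K V) (y y' : ℝ)
    (x x' : C(Icc (0 : ℝ) (Real.pi / 2), ℝ × ℝ)) :
    ‖polarOperator lam hV y x - polarOperator lam hV y' x'‖ ≤
      |y - y'| + K / lam * ‖x - x'‖ := by
  have hc : Continuous fun s => V (unweight lam x s) := hV.comp (continuous_unweight lam x)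
  have hc' : Continuous fun s => V (unweight lam x' s) := hV.comp (continuous_unweight lam x')
  rw [ContinuousMap.norm_le _ (by positivity)]
  rintro ⟨φ, hφ⟩
  have hVd : ∀ s, ‖V (unweight lam x s) - V (unweight lam x' s)‖ ≤
      K * ‖x - x'‖ * Real.exp (lam * s) := by
    intro s
    have h1 := hK.dist_le_mul (unweight lam x s) (unweight lam x' s)
    rw [dist_eq_norm, dist_eq_norm] at h1
    calc _ ≤ _ := h1
      _ ≤ K * (Real.exp (lam * s) * ‖x - x'‖) := by gcongr; exact norm_unweight_sub_le lam x x' s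
      _ = _ := by ring
  have hint := exp_weight_integral_le (φ := φ) (a := K * ‖x - x'‖) (by positivity) hl
  have hgc : Continuous fun s => K * ‖x - x'‖ * Real.exp (lam * s) := by fun_prop
  have hexp : Real.exp (-(lam * φ)) ≤ 1 := by
    rw [Real.exp_le_one_iff]; nlinarith [hφ.1]
  have he := Real.exp_pos (-(lam * φ))
  have hA : Real.exp (-(lam * φ)) * ∫ s in (0 : ℝ)..φ, K * ‖x - x'‖ * Real.exp (lam * s) ≤
      K / lam * ‖x - x'‖ := by
    calc _ ≤ _ := hint
      _ = _ := by ring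
  simp only [ContinuousMap.sub_apply, polarOperator, ContinuousMap.coe_mk]
  rw [← smul_sub, norm_smul, Real.norm_eq_abs, abs_of_pos he, Prod.norm_def]
  rw [mul_max_of_nonneg _ _ he.le]
  apply max_le
  · have h1 : |∫ s in (0 : ℝ)..φ, ((V (unweight lam x s)).1 - (V (unweight lam x' s)).1)| ≤
        ∫ s in (0 : ℝ)..φ, K * ‖x - x'‖ * Real.exp (lam * s) := by
      rw [← Real.norm_eq_abs]
      apply intervalIntegral.norm_integral_le_of_norm_le hφ.1
      · refine MeasureTheory.ae_of_all _ fun s hs => ?_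
        exact (norm_fst_le (V (unweight lam x s) - V (unweight lam x' s))).trans (hVd s)
      · exact hgc.intervalIntegrable _ _
    rw [intervalIntegral.integral_sub (hc.fst.intervalIntegrable _ _)
      (hc'.fst.intervalIntegrable _ _)] at h1
    simp only [Prod.fst_sub, Real.norm_eq_abs]
    rw [add_sub_add_comm]
    calc _ ≤ Real.exp (-(lam * φ)) * (|y - y'| + _) := by gcongr; exact abs_add_le _ _
      _ ≤ Real.exp (-(lam * φ)) * |y - y'| + Real.exp (-(lam * φ)) *
            ∫ s in (0 : ℝ)..φ, K * ‖x - x'‖ * Real.exp (lam * s) := by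
          rw [mul_add]; gcongr
      _ ≤ 1 * |y - y'| + K / lam * ‖x - x'‖ := by gcongr
      _ = _ := by ring
  · simp only [Prod.snd_sub, Real.norm_eq_abs]
    rw [sinAverage_sub hc.snd hc'.snd]
    have h1 := abs_sinAverage_le hgc hφ.1 hφ.2 (fun s _ =>
      (norm_snd_le (V (unweight lam x s) - V (unweight lam x' s))).trans (hVd s))
    calc _ ≤ Real.exp (-(lam * φ)) * _ := by gcongr; exact h1
      _ ≤ _ := hA
      _ ≤ _ := le_add_of_nonneg_left (abs_nonneg _)

end PolarOperator

/-- For a Lipschitz `V` vanishing at the origin the singular system has a family of solutions that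
depends Lipschitz continuously on the initial value. -/
theorem exists_polarSolution_family {V : ℝ × ℝ → ℝ × ℝ} {K : NNReal} (hK : LipschitzWith K V)
    (hV0 : V 0 = 0) :
    ∃ (L : ℝ) (x : ℝ → ℝ → ℝ × ℝ), 0 < L ∧ (∀ y, IsPolarSolution V y (x y)) ∧
      (∀ φ, x 0 φ = 0) ∧ ∀ y y' φ, ‖x y φ - x y' φ‖ ≤ L * |y - y'| := by
  have hp : (0 : ℝ) ≤ Real.pi / 2 := by positivity
  -- Chosen so that the contraction factor `K / lam` is at most `1 / 2`.
  set lam : ℝ := 2 * (K + 1) with hlam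
  have hl : 0 < lam := by positivity
  have hKl : (K : ℝ) / lam ≤ 1 / 2 := by
    rw [div_le_div_iff₀ hl two_pos, hlam]; linarith
  have hc : ∀ y, ContractingWith (1 / 2) (polarOperator lam hK.continuous y) := by
    intro y
    refine ⟨by norm_num [NNReal.half_lt_self], LipschitzWith.of_dist_le_mul fun x x' => ?_⟩
    rw [dist_eq_norm, dist_eq_norm]
    have := norm_polarOperator_sub_le lam hK.continuous hl hK y y x x'
    rw [sub_self, abs_zero, zero_add] at this
    refine this.trans ?_
    push_cast
    gcongr
  set X : ℝ → C(Icc (0 : ℝ) (Real.pi / 2), ℝ × ℝ) := fun y =>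
    ContractingWith.fixedPoint _ (hc y) with hX
  have hfix : ∀ y, polarOperator lam hK.continuous y (X y) = X y := fun y =>
    (hc y).fixedPoint_isFixedPt
  have hX0 : X 0 = 0 := by
    symm
    apply (hc 0).fixedPoint_unique
    ext φ <;> simp [polarOperator, unweight, hV0, sinAverage, IccExtend]
  have hXd : ∀ y y', ‖X y - X y'‖ ≤ 2 * |y - y'| := by
    intro y y'
    have h1 := norm_polarOperator_sub_le lam hK.continuous hl hK y y' (X y) (X y')
    rw [hfix, hfix] at h1
    have h2 : K / lam * ‖X y - X y'‖ ≤ 1 / 2 * ‖X y - X y'‖ := by gcongr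
    linarith
  -- Clamping the argument extends the solutions by constants, so that continuity and the Lipschitz
  -- bound hold on the whole line.
  set x : ℝ → ℝ → ℝ × ℝ := fun y φ => unweight lam (X y) (projIcc 0 (Real.pi / 2) hp φ) with hx
  have hxeq : ∀ y, ∀ φ ∈ Icc 0 (Real.pi / 2), x y φ = unweight lam (X y) φ := by
    intro y φ hφ
    simp only [hx, projIcc_of_mem hp hφ]
  refine ⟨2 * Real.exp (lam * (Real.pi / 2)), x, by positivity, fun y => ⟨?_, ?_, ?_⟩, ?_, ?_⟩
  · exact (continuous_unweight lam _).comp (continuous_subtype_val.comp continuous_projIcc)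
  · intro φ hφ
    have h1 := congrArg (fun g => (Real.exp (lam * φ) • g ⟨φ, hφ⟩).1) (hfix y)
    simp only [polarOperator, ContinuousMap.coe_mk, smul_smul, ← Real.exp_add, add_neg_cancel,
      Real.exp_zero, one_smul] at h1
    rw [hxeq y φ hφ, unweight, IccExtend_of_mem _ _ hφ, ← h1]
    congr 1
    apply intervalIntegral.integral_congr
    intro s hs
    rw [uIcc_of_le hφ.1] at hs
    simp only [hxeq y s ⟨hs.1, hs.2.trans hφ.2⟩]
  · intro φ hφ
    have h1 := congrArg (fun g => (Real.exp (lam * φ) • g ⟨φ, hφ⟩).2) (hfix y)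
    simp only [polarOperator, ContinuousMap.coe_mk, smul_smul, ← Real.exp_add, add_neg_cancel,
      Real.exp_zero, one_smul] at h1
    rw [hxeq y φ hφ, unweight, IccExtend_of_mem _ _ hφ, ← h1, sinAverage, sinAverage]
    congr 1
    apply intervalIntegral.integral_congr
    intro s hs
    rw [uIcc_of_le hφ.1] at hs
    simp only [hxeq y s ⟨hs.1, hs.2.trans hφ.2⟩]
  · intro φ
    simp [hx, hX0, unweight, IccExtend]
  · intro y y' φ
    refine (norm_unweight_sub_le lam _ _ _).trans ?_
    have h3 := (projIcc 0 (Real.pi / 2) hp φ).2.2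
    calc _ ≤ Real.exp (lam * (Real.pi / 2)) * (2 * |y - y'|) := by
            gcongr
            exact hXd y y'
      _ = _ := by ring

namespace IsPolarSolution

variable {V : ℝ × ℝ → ℝ × ℝ} {y : ℝ} {x : ℝ → ℝ × ℝ}

lemma hasDerivAt_fst (h : IsPolarSolution V y x) (hV : Continuous V) {φ : ℝ}
    (hφ : φ ∈ Ioo 0 (Real.pi / 2)) : HasDerivAt (fun φ => (x φ).1) (V (x φ)).1 φ := by
  have hc := (hV.comp h.continuous).fst
  have h1 : HasDerivAt (fun φ => y + ∫ s in (0 : ℝ)..φ, (V (x s)).1) (V (x φ)).1 φ :=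
    (intervalIntegral.integral_hasDerivAt_right (hc.intervalIntegrable _ _)
      (hc.stronglyMeasurableAtFilter _ _) hc.continuousAt).const_add y
  apply h1.congr_of_eventuallyEq
  filter_upwards [Ioo_mem_nhds hφ.1 hφ.2] with t ht
  exact h.fst_eq t ⟨ht.1.le, ht.2.le⟩

lemma hasDerivAt_snd (h : IsPolarSolution V y x) (hV : Continuous V) {φ : ℝ}
    (hφ : φ ∈ Ioo 0 (Real.pi / 2)) :
    HasDerivAt (fun φ => (x φ).2) ((V (x φ)).2 - Real.cos φ / Real.sin φ * (x φ).2) φ := by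
  have hc := (hV.comp h.continuous).snd
  have hs : Real.sin φ ≠ 0 :=
    (Real.sin_pos_of_pos_of_lt_pi hφ.1 (by linarith [hφ.2, Real.pi_pos])).ne'
  have h1 := hasDerivAt_sinAverage hc hs
  rw [h.snd_eq φ ⟨hφ.1.le, hφ.2.le⟩]
  apply h1.congr_of_eventuallyEq
  filter_upwards [Ioo_mem_nhds hφ.1 hφ.2] with t ht
  exact h.snd_eq t ⟨ht.1.le, ht.2.le⟩

lemma fst_zero (h : IsPolarSolution V y x) : (x 0).1 = y := by
  simpa using h.fst_eq 0 ⟨le_rfl, by positivity⟩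

lemma snd_zero (h : IsPolarSolution V y x) : (x 0).2 = 0 := by
  simpa [sinAverage] using h.snd_eq 0 ⟨le_rfl, by positivity⟩

end IsPolarSolution

/-! ### Elementary estimates near the angle `π / 2` -/

/-- Mean value inequality with derivative bounded in the interior. -/
lemma abs_sub_le_of_hasDerivAt_Ioo {u u' : ℝ → ℝ} {a b C : ℝ} (hab : a ≤ b)
    (hc : ContinuousOn u (Icc a b)) (hd : ∀ t ∈ Ioo a b, HasDerivAt u (u' t) t)
    (hb : ∀ t ∈ Ioo a b, |u' t| ≤ C) : |u b - u a| ≤ (b - a) * C := by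
  rcases hab.eq_or_lt with rfl | hab
  · simp
  obtain ⟨t, ht, he⟩ := exists_hasDerivAt_eq_slope u u' hab hc hd
  have hba : 0 < b - a := sub_pos.2 hab
  have h1 : u b - u a = (b - a) * u' t := by
    rw [he]; field_simp
  rw [h1, abs_mul, abs_of_pos hba]
  exact mul_le_mul_of_nonneg_left (hb t ht) hba.le

lemma abs_cos_le_abs_sub_pi_div_two (x : ℝ) : |Real.cos x| ≤ |x - Real.pi / 2| := by
  have h : Real.cos x = -Real.sin (x - Real.pi / 2) := by rw [Real.sin_sub_pi_div_two, neg_neg]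
  rw [h, abs_neg]
  exact Real.abs_sin_le_abs

/-- The sine is stationary at `π / 2`; the extra factor `ε` is what lets the uniqueness argument at
the axis close. -/
lemma abs_sin_sub_sin_le_mul {a b ε : ℝ} (ha : |a - Real.pi / 2| ≤ ε) (hb : |b - Real.pi / 2| ≤ ε) :
    |Real.sin a - Real.sin b| ≤ ε * |a - b| := by
  rw [Real.sin_sub_sin, abs_mul, abs_mul, abs_two]
  have h1 : |Real.sin ((a - b) / 2)| ≤ |a - b| / 2 := by
    refine Real.abs_sin_le_abs.trans ?_
    rw [abs_div, abs_two]
  have h2 : |Real.cos ((a + b) / 2)| ≤ ε := by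
    refine (abs_cos_le_abs_sub_pi_div_two _).trans ?_
    rw [abs_le] at *
    constructor <;> linarith [ha.1, ha.2, hb.1, hb.2]
  have h3 := mul_le_mul h1 h2 (abs_nonneg _) (by positivity)
  nlinarith

lemma abs_sub_le_mul_abs_cos_sub_cos {a b : ℝ} (ha : |a - Real.pi / 2| ≤ 1 / 2)
    (hb : |b - Real.pi / 2| ≤ 1 / 2) : |a - b| ≤ 4 * |Real.cos a - Real.cos b| := by
  rw [Real.cos_sub_cos, abs_mul, abs_mul, abs_neg, abs_two]
  rw [abs_le] at ha hb
  have hpi := Real.pi_gt_three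
  have hpi4 := Real.pi_lt_d2
  have h1 : 1 / 2 ≤ |Real.sin ((a + b) / 2)| := by
    refine le_trans ?_ (le_abs_self _)
    have h : Real.sin ((a + b) / 2) = Real.cos ((a + b) / 2 - Real.pi / 2) := by
      rw [Real.cos_sub_pi_div_two]
    rw [h]
    have := Real.one_sub_sq_div_two_le_cos (x := (a + b) / 2 - Real.pi / 2)
    nlinarith [ha.1, ha.2, hb.1, hb.2]
  have h2 : 2 / Real.pi * |(a - b) / 2| ≤ |Real.sin ((a - b) / 2)| := by
    apply Real.mul_abs_le_abs_sin
    rw [abs_le]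
    constructor <;> linarith [ha.1, ha.2, hb.1, hb.2]
  have h3 : 1 / 2 ≤ 2 / Real.pi := by
    rw [div_le_div_iff₀ two_pos Real.pi_pos]; linarith
  rw [abs_div, abs_two] at h2
  have h4 : 1 / 2 * (|a - b| / 2) ≤ 2 / Real.pi * (|a - b| / 2) := by gcongr
  have h5 := mul_le_mul h1 (h4.trans h2) (by positivity) (abs_nonneg _)
  nlinarith

/-! ### Uniqueness of orbits issuing from the axis -/

namespace IsCapOrbit

variable {c T T' : ℝ} {z r θ z' r' θ' : ℝ → ℝ}

/-- Multiplying `cos θ` by `r` cancels the singular term `cos θ / r` of `θ'`, because `sin² θ + r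
(cos θ)' = 0` to leading order as far as that term is concerned. -/
lemma hasDerivAt_r_mul_cos (h : IsCapOrbit c T z r θ) {t : ℝ} (ht : t ∈ Ioo 0 T) :
    HasDerivAt (fun t => r t * Real.cos (θ t))
      (-(r t * (z t * Real.sin (θ t) ^ 2 - r t * Real.sin (θ t) * Real.cos (θ t)))) t := by
  have hr := (h.r_pos t ⟨ht.1, ht.2.le⟩).ne'
  refine ((h.deriv_r t ht).mul (h.deriv_θ t ht).cos).congr_deriv ?_
  field_simp
  ring

lemma r_le (h : IsCapOrbit c T z r θ) {t : ℝ} (ht : t ∈ Icc 0 T) : r t ≤ t := by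
  have := abs_sub_le_of_hasDerivAt_Ioo ht.1 (h.continuousOn_r.mono (Icc_subset_Icc_right ht.2))
    (fun s hs => h.deriv_r s ⟨hs.1, hs.2.trans_le ht.2⟩)
    (fun s _ => Real.abs_sin_le_one _)
  rw [h.r_zero] at this
  linarith [le_abs_self (r t - 0)]

lemma half_le_r (h : IsCapOrbit c T z r θ) {t : ℝ} (ht : t ∈ Icc 0 T)
    (hs : ∀ s ∈ Ioo 0 t, |θ s - Real.pi / 2| ≤ 1 / 2) : t / 2 ≤ r t := by
  rcases ht.1.eq_or_lt with rfl | h0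
  · simp [h.r_zero]
  obtain ⟨s, hs', he⟩ := exists_hasDerivAt_eq_slope r (fun t => Real.sin (θ t)) h0
    (h.continuousOn_r.mono (Icc_subset_Icc_right ht.2))
    (fun s hs => h.deriv_r s ⟨hs.1, hs.2.trans_le ht.2⟩)
  rw [h.r_zero, sub_zero, sub_zero, eq_div_iff h0.ne'] at he
  have h1 := hs s hs'
  have h2 := Real.one_sub_sq_div_two_le_cos (x := θ s - Real.pi / 2)
  rw [Real.cos_sub_pi_div_two] at h2
  rw [abs_le] at h1
  have h3 : 1 / 2 ≤ Real.sin (θ s) := by nlinarith [h1.1, h1.2]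
  nlinarith

lemma eventually_near (h : IsCapOrbit c T z r θ) {ε : ℝ} (hε : 0 < ε) :
    ∀ᶠ t in 𝓝[≥] (0 : ℝ), |z t| ≤ |c| + 1 ∧ |θ t - Real.pi / 2| ≤ ε ∧ t ≤ ε ∧ t ≤ T := by
  have hle : 𝓝[≥] (0 : ℝ) = 𝓝[Icc 0 T] 0 := (nhdsWithin_Icc_eq_nhdsGE h.T_pos).symm
  have hz : Tendsto z (𝓝[≥] 0) (𝓝 c) := by
    rw [hle, ← h.z_zero]; exact h.continuousOn_z 0 ⟨le_rfl, h.T_pos.le⟩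
  have hθ : Tendsto θ (𝓝[≥] 0) (𝓝 (Real.pi / 2)) := by
    rw [hle, ← h.θ_zero]; exact h.continuousOn_θ 0 ⟨le_rfl, h.T_pos.le⟩
  have h1 : ∀ᶠ t in 𝓝[≥] (0 : ℝ), |z t| < |c| + 1 := hz.abs.eventually_lt_const (by linarith)
  have h2 : ∀ᶠ t in 𝓝[≥] (0 : ℝ), |θ t - Real.pi / 2| < ε := by
    refine (hθ.sub_const (Real.pi / 2)).abs.eventually_lt_const ?_
    simpa using hε
  have h3 : ∀ᶠ t in 𝓝[≥] (0 : ℝ), t < ε := eventually_nhdsWithin_of_eventually_nhds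
    (eventually_lt_nhds hε)
  have h4 : ∀ᶠ t in 𝓝[≥] (0 : ℝ), t < T := eventually_nhdsWithin_of_eventually_nhds
    (eventually_lt_nhds h.T_pos)
  filter_upwards [h1, h2, h3, h4] with t a1 a2 a3 a4
  exact ⟨a1.le, a2.le, a3.le, a4.le⟩

/-- The difference of the two values of `r (z sin² θ - r sin θ cos θ)`, in terms of the differences
of `z`, `r`, `sin θ` and `cos θ`. -/
lemma abs_moment_sub_le {z₁ z₂ r₁ r₂ s₁ s₂ c₁ c₂ M ε t m : ℝ} (hM : 0 ≤ M) (hε1 : ε ≤ 1)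
    (htε : t ≤ ε) (hm : 0 ≤ m) (hz₁ : |z₁| ≤ M)
    (hr₁0 : 0 ≤ r₁) (hr₁ : r₁ ≤ t) (hr₂0 : 0 ≤ r₂) (hr₂ : r₂ ≤ t)
    (hs₁ : |s₁| ≤ 1) (hs₂ : |s₂| ≤ 1) (hc₁ : |c₁| ≤ 1)
    (hz : |z₁ - z₂| ≤ t * m) (hr : |r₁ - r₂| ≤ t * (ε * m)) (hs : |s₁ - s₂| ≤ ε * m)
    (hc : |c₁ - c₂| ≤ m) :
    |r₁ * (z₁ * s₁ ^ 2 - r₁ * s₁ * c₁) - r₂ * (z₂ * s₂ ^ 2 - r₂ * s₂ * c₂)| ≤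
      t * (ε * m * (5 + 3 * M)) := by
  have ht0 : 0 ≤ t := hr₁0.trans hr₁
  have hε0 : 0 ≤ ε := ht0.trans htε
  have hem : 0 ≤ ε * m := mul_nonneg hε0 hm
  have htm : t * m ≤ ε * m := by gcongr
  have hsq : ∀ {x : ℝ}, |x| ≤ 1 → |x ^ 2| ≤ 1 := fun {x} hx => by
    rw [abs_pow]; exact pow_le_one₀ (abs_nonneg _) hx
  have hH1 : |z₁ * s₁ ^ 2 - r₁ * s₁ * c₁| ≤ M + 1 := by
    refine (abs_sub _ _).trans ?_
    rw [abs_mul, abs_mul, abs_mul, abs_of_nonneg hr₁0]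
    have a1 : |z₁| * |s₁ ^ 2| ≤ M * 1 := by gcongr; exact hsq hs₁
    have a2 : r₁ * |s₁| * |c₁| ≤ 1 * 1 * 1 := by gcongr; linarith
    linarith
  have hd : |(z₁ * s₁ ^ 2 - r₁ * s₁ * c₁) - (z₂ * s₂ ^ 2 - r₂ * s₂ * c₂)| ≤
      ε * m * (4 + 2 * M) := by
    have e : (z₁ * s₁ ^ 2 - r₁ * s₁ * c₁) - (z₂ * s₂ ^ 2 - r₂ * s₂ * c₂) =
      ((z₁ - z₂) * s₂ ^ 2 + z₁ * ((s₁ - s₂) * (s₁ + s₂))) -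
        ((r₁ - r₂) * (s₁ * c₁) + (r₂ * ((s₁ - s₂) * c₁) + r₂ * (s₂ * (c₁ - c₂)))) := by ring
    rw [e]
    refine (abs_sub _ _).trans ?_
    have b1 : |(z₁ - z₂) * s₂ ^ 2 + z₁ * ((s₁ - s₂) * (s₁ + s₂))| ≤ ε * m + M * (ε * m * 2) := by
      refine (abs_add_le _ _).trans ?_
      rw [abs_mul, abs_mul, abs_mul (s₁ - s₂)]
      have d1 : |z₁ - z₂| * |s₂ ^ 2| ≤ t * m * 1 := by gcongr; exact hsq hs₂
      have d2 : |s₁ + s₂| ≤ 2 := (abs_add_le _ _).trans (by linarith)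
      have d3 : |z₁| * (|s₁ - s₂| * |s₁ + s₂|) ≤ M * (ε * m * 2) := by gcongr
      linarith
    have b2 : |(r₁ - r₂) * (s₁ * c₁) + (r₂ * ((s₁ - s₂) * c₁) + r₂ * (s₂ * (c₁ - c₂)))| ≤
        ε * m * 3 := by
      refine (abs_add_le _ _).trans ?_
      have d0 := abs_add_le (r₂ * ((s₁ - s₂) * c₁)) (r₂ * (s₂ * (c₁ - c₂)))
      rw [abs_mul r₂, abs_mul r₂, abs_mul (s₁ - s₂), abs_mul s₂, abs_of_nonneg hr₂0] at d0
      rw [abs_mul, abs_mul s₁]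
      have d1 : |r₁ - r₂| * (|s₁| * |c₁|) ≤ 1 * (ε * m) * (1 * 1) := by
        gcongr
        refine hr.trans ?_
        gcongr
        linarith
      have d2 : r₂ * (|s₁ - s₂| * |c₁|) ≤ 1 * (ε * m * 1) := by gcongr; linarith
      have d3 : r₂ * (|s₂| * |c₁ - c₂|) ≤ ε * (1 * m) := by gcongr; linarith
      linarith
    linarith
  have e : r₁ * (z₁ * s₁ ^ 2 - r₁ * s₁ * c₁) - r₂ * (z₂ * s₂ ^ 2 - r₂ * s₂ * c₂) =
    (r₁ - r₂) * (z₁ * s₁ ^ 2 - r₁ * s₁ * c₁) +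
      r₂ * ((z₁ * s₁ ^ 2 - r₁ * s₁ * c₁) - (z₂ * s₂ ^ 2 - r₂ * s₂ * c₂)) := by ring
  rw [e]
  refine (abs_add_le _ _).trans ?_
  rw [abs_mul, abs_mul r₂, abs_of_nonneg hr₂0]
  have c1 : |r₁ - r₂| * |z₁ * s₁ ^ 2 - r₁ * s₁ * c₁| ≤ t * (ε * m) * (M + 1) := by gcongr
  have c2 : r₂ * |(z₁ * s₁ ^ 2 - r₁ * s₁ * c₁) - (z₂ * s₂ ^ 2 - r₂ * s₂ * c₂)| ≤
    t * (ε * m * (4 + 2 * M)) := by gcongr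
  linarith

/-- Let `m` be the maximum of `|θ - θ'|` on a short interval. Integration gives differences of size
`t m` for `z`, `t ε m` for `r` and `t² ε m` for `r cos θ`. Since `r ≥ t / 2`, division recovers the
difference of the cosines, hence of the angles, with a factor below `1` in front of `m`; so `m = 0`.
-/
theorem eqOn_near_zero (h : IsCapOrbit c T z r θ) (h' : IsCapOrbit c T' z' r' θ') :
    ∃ t₀ > 0, t₀ ≤ T ∧ t₀ ≤ T' ∧ ∀ t ∈ Icc 0 t₀, z t = z' t ∧ r t = r' t ∧ θ t = θ' t := by
  set M := |c| + 1 with hM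
  have hM1 : 1 ≤ M := by linarith [abs_nonneg c]
  -- Small enough that `ε² (12 + 6 M) ≤ 1 / 8`, which beats the factor `4` lost in passing from
  -- cosines back to angles.
  set ε := 1 / (100 * M) with hεdef
  have hε : 0 < ε := by positivity
  have hεM : ε * M = 1 / 100 := by rw [hεdef]; field_simp
  have hε1 : ε ≤ 1 / 100 := by nlinarith
  obtain ⟨t₀, ht₀, hsub⟩ := mem_nhdsGE_iff_exists_Icc_subset.1
    ((h.eventually_near hε).and (h'.eventually_near hε))
  have ht₀0 : 0 < t₀ := ht₀
  have hT := (hsub ⟨ht₀0.le, le_rfl⟩).1.2.2.2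
  have hT' := (hsub ⟨ht₀0.le, le_rfl⟩).2.2.2.2
  refine ⟨t₀, ht₀0, hT, hT', ?_⟩
  have hI : ∀ {t}, t ∈ Icc 0 t₀ → t ∈ Icc 0 T := fun ht => ⟨ht.1, ht.2.trans hT⟩
  have hI' : ∀ {t}, t ∈ Icc 0 t₀ → t ∈ Icc 0 T' := fun ht => ⟨ht.1, ht.2.trans hT'⟩
  have hθ : ∀ t ∈ Icc 0 t₀, |θ t - Real.pi / 2| ≤ ε := fun t ht => (hsub ht).1.2.1
  have hθ' : ∀ t ∈ Icc 0 t₀, |θ' t - Real.pi / 2| ≤ ε := fun t ht => (hsub ht).2.2.1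
  have hz : ∀ t ∈ Icc 0 t₀, |z t| ≤ M := fun t ht => (hsub ht).1.1
  have htε : ∀ t ∈ Icc 0 t₀, t ≤ ε := fun t ht => (hsub ht).1.2.2.1
  have hcont : ContinuousOn (fun t => |θ t - θ' t|) (Icc 0 t₀) :=
    ((h.continuousOn_θ.mono fun _ => hI).sub (h'.continuousOn_θ.mono fun _ => hI')).abs
  obtain ⟨tm, htm, hmax⟩ := isCompact_Icc.exists_isMaxOn (nonempty_Icc.2 ht₀0.le) hcont
  set m := |θ tm - θ' tm| with hm
  have hm0 : 0 ≤ m := abs_nonneg _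
  have hmle : ∀ t ∈ Icc 0 t₀, |θ t - θ' t| ≤ m := fun t ht => hmax ht
  have hcos : ∀ t ∈ Icc 0 t₀, |Real.cos (θ t) - Real.cos (θ' t)| ≤ m := fun t ht =>
    (Real.abs_cos_sub_cos_le _ _).trans (hmle t ht)
  have hsin : ∀ t ∈ Icc 0 t₀, |Real.sin (θ t) - Real.sin (θ' t)| ≤ ε * m := fun t ht =>
    (abs_sin_sub_sin_le_mul (hθ t ht) (hθ' t ht)).trans
      (mul_le_mul_of_nonneg_left (hmle t ht) hε.le)
  have hmono : ∀ {t}, t ∈ Icc 0 t₀ → ∀ s ∈ Ioo 0 t, s ∈ Icc 0 t₀ ∧ s ∈ Ioo 0 T ∧ s ∈ Ioo 0 T' :=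
    fun {t} ht s hs => ⟨⟨hs.1.le, hs.2.le.trans ht.2⟩, ⟨hs.1, (hs.2.trans_le ht.2).trans_le hT⟩,
      ⟨hs.1, (hs.2.trans_le ht.2).trans_le hT'⟩⟩
  have hdz : ∀ t ∈ Icc 0 t₀, |z t - z' t| ≤ t * m := by
    intro t ht
    have := abs_sub_le_of_hasDerivAt_Ioo (u := fun t => z t - z' t) ht.1
      ((h.continuousOn_z.mono (Icc_subset_Icc_right (hI ht).2)).sub
        (h'.continuousOn_z.mono (Icc_subset_Icc_right (hI' ht).2)))
      (fun s hs => (h.deriv_z s (hmono ht s hs).2.1).sub (h'.deriv_z s (hmono ht s hs).2.2))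
      (fun s hs => hcos s (hmono ht s hs).1)
    simpa [h.z_zero, h'.z_zero] using this
  have hdr : ∀ t ∈ Icc 0 t₀, |r t - r' t| ≤ t * (ε * m) := by
    intro t ht
    have := abs_sub_le_of_hasDerivAt_Ioo (u := fun t => r t - r' t) ht.1
      ((h.continuousOn_r.mono (Icc_subset_Icc_right (hI ht).2)).sub
        (h'.continuousOn_r.mono (Icc_subset_Icc_right (hI' ht).2)))
      (fun s hs => (h.deriv_r s (hmono ht s hs).2.1).sub (h'.deriv_r s (hmono ht s hs).2.2))
      (fun s hs => hsin s (hmono ht s hs).1)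
    simpa [h.r_zero, h'.r_zero] using this
  have hdG : ∀ t ∈ Icc 0 t₀, |r t * Real.cos (θ t) - r' t * Real.cos (θ' t)| ≤
      t * (t * (ε * m * (5 + 3 * M))) := by
    intro t ht
    have := abs_sub_le_of_hasDerivAt_Ioo
      (u := fun t => r t * Real.cos (θ t) - r' t * Real.cos (θ' t)) ht.1
      (((h.continuousOn_r.mul (Real.continuous_cos.comp_continuousOn h.continuousOn_θ)).mono (Icc_subset_Icc_right (hI ht).2)).sub
        ((h'.continuousOn_r.mul (Real.continuous_cos.comp_continuousOn h'.continuousOn_θ)).mono (Icc_subset_Icc_right (hI' ht).2)))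
      (fun s hs => (h.hasDerivAt_r_mul_cos (hmono ht s hs).2.1).sub
        (h'.hasDerivAt_r_mul_cos (hmono ht s hs).2.2))
      (C := t * (ε * m * (5 + 3 * M))) ?_
    · simpa [h.r_zero, h'.r_zero] using this
    · intro s hs
      obtain ⟨b1, b2, b3⟩ := hmono ht s hs
      rw [neg_sub_neg, abs_sub_comm]
      refine (abs_moment_sub_le (by linarith) (by linarith) (htε s b1) hm0 (hz s b1)
        (h.r_pos s ⟨b2.1, b2.2.le⟩).le (h.r_le ⟨b2.1.le, b2.2.le⟩)
        (h'.r_pos s ⟨b3.1, b3.2.le⟩).le (h'.r_le ⟨b3.1.le, b3.2.le⟩)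
        (Real.abs_sin_le_one _) (Real.abs_sin_le_one _) (Real.abs_cos_le_one _)
        (hdz s b1) (hdr s b1) (hsin s b1) (hcos s b1)).trans ?_
      have := hs.2.le
      gcongr
  have hmz : m = 0 := by
    rcases htm.1.eq_or_lt with h0 | h0
    · rw [hm, ← h0, h.θ_zero, h'.θ_zero, sub_self, abs_zero]
    have hr2 : tm / 2 ≤ r tm := h.half_le_r (hI htm) fun s hs =>
      (hθ s (hmono htm s hs).1).trans (by linarith)
    have hc2 : |Real.cos (θ' tm)| ≤ ε := (abs_cos_le_abs_sub_pi_div_two _).trans (hθ' tm htm)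
    have e : r tm * (Real.cos (θ tm) - Real.cos (θ' tm)) =
      (r tm * Real.cos (θ tm) - r' tm * Real.cos (θ' tm)) -
        (r tm - r' tm) * Real.cos (θ' tm) := by ring
    have h1 : |r tm * (Real.cos (θ tm) - Real.cos (θ' tm))| ≤
        tm * (ε * (ε * m * (5 + 3 * M))) + tm * (ε * m) * ε := by
      rw [e]
      refine (abs_sub _ _).trans ?_
      rw [abs_mul (r tm - r' tm)]
      apply add_le_add
      · refine (hdG tm htm).trans ?_
        have := htε tm htm
        gcongr
      · exact mul_le_mul (hdr tm htm) hc2 (abs_nonneg _) (by positivity)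
    rw [abs_mul, abs_of_nonneg (by linarith)] at h1
    have h2 : tm / 2 * |Real.cos (θ tm) - Real.cos (θ' tm)| ≤
        r tm * |Real.cos (θ tm) - Real.cos (θ' tm)| := by gcongr
    have h3 : tm * |Real.cos (θ tm) - Real.cos (θ' tm)| ≤ tm * (ε ^ 2 * m * (12 + 6 * M)) := by
      nlinarith
    have h4 := le_of_mul_le_mul_left h3 h0
    have h5 := abs_sub_le_mul_abs_cos_sub_cos ((hθ tm htm).trans (by linarith))
      ((hθ' tm htm).trans (by linarith))
    have h6 : ε ^ 2 * m * (12 + 6 * M) ≤ 1 / 8 * m := by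
      have : ε ^ 2 * (12 + 6 * M) ≤ 1 / 8 := by nlinarith
      nlinarith
    linarith
  intro t ht
  have e1 := hdz t ht
  have e2 := hdr t ht
  have e3 := hmle t ht
  rw [hmz] at e1 e2 e3
  simp only [mul_zero, abs_nonpos_iff, sub_eq_zero] at e1 e2 e3
  exact ⟨e1, e2, e3⟩

/-- The vector field of the profile-curve system. -/
noncomputable def field (p : ℝ × ℝ × ℝ) : ℝ × ℝ × ℝ :=
  (Real.cos p.2.2, Real.sin p.2.2,
    p.1 * Real.sin p.2.2 + (1 / p.2.1 - p.2.1) * Real.cos p.2.2)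

lemma contDiffAt_field {p : ℝ × ℝ × ℝ} (hp : p.2.1 ≠ 0) : ContDiffAt ℝ 1 field p := by
  unfold field
  fun_prop (disch := assumption)

lemma hasDerivAt_field (h : IsCapOrbit c T z r θ) {t : ℝ} (ht : t ∈ Ioo 0 T) :
    HasDerivAt (fun t => (z t, r t, θ t)) (field (z t, r t, θ t)) t :=
  (h.deriv_z t ht).prodMk ((h.deriv_r t ht).prodMk (h.deriv_θ t ht))

/-- Agreement near the axis is continued to later times, where `r > 0` and the field is locally
Lipschitz. -/
theorem eqOn (h : IsCapOrbit c T z r θ) (h' : IsCapOrbit c T' z' r' θ') :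
    ∀ t ∈ Icc 0 (min T T'), z t = z' t ∧ r t = r' t ∧ θ t = θ' t := by
  obtain ⟨t₀, ht₀, hT, hT', heq⟩ := h.eqOn_near_zero h'
  have hcX : ContinuousOn (fun t => (z t, r t, θ t)) (Icc 0 T) :=
    h.continuousOn_z.prodMk (h.continuousOn_r.prodMk h.continuousOn_θ)
  have hcX' : ContinuousOn (fun t => (z' t, r' t, θ' t)) (Icc 0 T') :=
    h'.continuousOn_z.prodMk (h'.continuousOn_r.prodMk h'.continuousOn_θ)
  have hsub : Icc t₀ (min T T') ⊆ {t | (z t, r t, θ t) = (z' t, r' t, θ' t)} := by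
    apply IsClosed.Icc_subset_of_forall_exists_gt
    · rw [inter_comm]
      exact ((hcX.mono (Icc_subset_Icc ht₀.le (min_le_left _ _))).prodMk
        (hcX'.mono (Icc_subset_Icc ht₀.le (min_le_right _ _)))).preimage_isClosed_of_isClosed
          isClosed_Icc isClosed_diagonal
    · obtain ⟨a1, a2, a3⟩ := heq t₀ ⟨ht₀.le, le_rfl⟩
      simp [a1, a2, a3]
    · rintro t ⟨hteq, ht⟩ y hy
      have ht0 : 0 < t := ht₀.trans_le ht.1
      have hr : r t ≠ 0 := (h.r_pos t ⟨ht0, ht.2.le.trans (min_le_left _ _)⟩).ne'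
      obtain ⟨K, s, hs, hK⟩ :=
        (contDiffAt_field (p := (z t, r t, θ t)) hr).exists_lipschitzOnWith
      have htT : t ∈ Ioo 0 T := ⟨ht0, ht.2.trans_le (min_le_left _ _)⟩
      have htT' : t ∈ Ioo 0 T' := ⟨ht0, ht.2.trans_le (min_le_right _ _)⟩
      have hev := ODE_solution_unique_of_eventually (v := fun _ => field) (s := fun _ => s)
        (t₀ := t) (f := fun t => (z t, r t, θ t)) (g := fun t => (z' t, r' t, θ' t))
        (Eventually.of_forall fun _ => hK)
        ((Filter.Eventually.mono (Ioo_mem_nhds htT.1 htT.2)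
          fun u hu => h.hasDerivAt_field hu).and
            ((h.hasDerivAt_field htT).continuousAt.eventually_mem hs))
        ((Filter.Eventually.mono (Ioo_mem_nhds htT'.1 htT'.2)
          fun u hu => h'.hasDerivAt_field hu).and
            ((h'.hasDerivAt_field htT').continuousAt.eventually_mem
              ((show (z t, r t, θ t) = (z' t, r' t, θ' t) from hteq) ▸ hs)))
        hteq
      have h2 : ∀ᶠ u in 𝓝[>] t, u ∈ Ioc t y := Ioc_mem_nhdsGT hy
      obtain ⟨u, hu1, hu2⟩ := ((hev.filter_mono nhdsWithin_le_nhds).and h2).exists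
      exact ⟨u, hu1, hu2⟩
  intro t ht
  rcases le_total t t₀ with hle | hle
  · exact heq t ⟨ht.1, hle⟩
  · simpa using hsub ⟨hle, ht.2⟩

end IsCapOrbit

/-! ### Cooperative planar linear systems -/

lemma le_of_hasDerivAt_nonneg_Ioo {u u' : ℝ → ℝ} {a b : ℝ} (hab : a ≤ b)
    (hc : ContinuousOn u (Icc a b)) (hd : ∀ t ∈ Ioo a b, HasDerivAt u (u' t) t)
    (hb : ∀ t ∈ Ioo a b, 0 ≤ u' t) : u a ≤ u b := by
  rcases hab.eq_or_lt with rfl | hab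
  · exact le_rfl
  obtain ⟨t, ht, he⟩ := exists_hasDerivAt_eq_slope u u' hab hc hd
  have h1 := hb t ht
  rw [he, div_nonneg_iff] at h1
  rcases h1 with h1 | h1 <;> linarith [h1.1, h1.2]

/-- A cooperative planar linear system with nonnegative coefficients increases both components of a
positive solution. -/
lemma le_of_cooperative_nonneg {X Y α β γ δ : ℝ → ℝ} {a b : ℝ}
    (hX : ContinuousOn X (Icc a b)) (hY : ContinuousOn Y (Icc a b))
    (hX' : ∀ t ∈ Ioo a b, HasDerivAt X (α t * X t + β t * Y t) t)
    (hY' : ∀ t ∈ Ioo a b, HasDerivAt Y (γ t * X t + δ t * Y t) t)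
    (hα : ∀ t ∈ Ioo a b, 0 ≤ α t) (hβ : ∀ t ∈ Ioo a b, 0 ≤ β t)
    (hγ : ∀ t ∈ Ioo a b, 0 ≤ γ t) (hδ : ∀ t ∈ Ioo a b, 0 ≤ δ t)
    (hXa : 0 < X a) (hYa : 0 < Y a) : ∀ t ∈ Icc a b, X a ≤ X t ∧ Y a ≤ Y t := by
  suffices h : Icc a b ⊆ {t | X a ≤ X t ∧ Y a ≤ Y t} from fun t ht => h ht
  apply IsClosed.Icc_subset_of_forall_exists_gt
  · have h1 := hX.preimage_isClosed_of_isClosed isClosed_Icc (isClosed_Ici (a := X a))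
    have h2 := hY.preimage_isClosed_of_isClosed isClosed_Icc (isClosed_Ici (a := Y a))
    convert h1.inter h2 using 1
    ext t
    simp only [mem_inter_iff, mem_ofPred_eq, mem_preimage, mem_Ici]
    tauto
  · exact ⟨le_rfl, le_rfl⟩
  · rintro t ⟨ht, htI⟩ y hy
    have htI' : t ∈ Icc a b := ⟨htI.1, htI.2.le⟩
    have hle : 𝓝[Icc t b] t ≤ 𝓝[Icc a b] t := nhdsWithin_mono _ (Icc_subset_Icc_left htI.1)
    have e1 : ∀ᶠ u in 𝓝[Icc t b] t, 0 < X u :=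
      ((hX t htI').mono_left hle).eventually_const_lt (hXa.trans_le ht.1)
    have e2 : ∀ᶠ u in 𝓝[Icc t b] t, 0 < Y u :=
      ((hY t htI').mono_left hle).eventually_const_lt (hYa.trans_le ht.2)
    have hmin : t < min y b := lt_min hy htI.2
    rw [nhdsWithin_Icc_eq_nhdsGE htI.2] at e1 e2
    obtain ⟨u, hu, hsub⟩ := (mem_nhdsGE_iff_exists_mem_Ioc_Ico_subset hmin).1 (e1.and e2)
    set v := min u (min y b) with hv
    have htv : t < v := lt_min hu.1 hmin
    have hvb : v ≤ b := (min_le_right _ _).trans (min_le_right _ _)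
    have hI : ∀ s ∈ Ioo t v, s ∈ Ioo a b ∧ 0 < X s ∧ 0 < Y s := fun s hs =>
      ⟨⟨htI.1.trans_lt hs.1, hs.2.trans_le hvb⟩,
        hsub ⟨hs.1.le, hs.2.trans_le (min_le_left _ _)⟩⟩
    refine ⟨v, ⟨ht.1.trans ?_, ht.2.trans ?_⟩, htv,
      (min_le_right _ _).trans (min_le_left _ _)⟩
    · refine le_of_hasDerivAt_nonneg_Ioo htv.le (hX.mono (Icc_subset_Icc htI.1 hvb))
        (fun s hs => hX' s (hI s hs).1) fun s hs => ?_
      obtain ⟨i1, i2, i3⟩ := hI s hs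
      exact add_nonneg (mul_nonneg (hα s i1) i2.le) (mul_nonneg (hβ s i1) i3.le)
    · refine le_of_hasDerivAt_nonneg_Ioo htv.le (hY.mono (Icc_subset_Icc htI.1 hvb))
        (fun s hs => hY' s (hI s hs).1) fun s hs => ?_
      obtain ⟨i1, i2, i3⟩ := hI s hs
      exact add_nonneg (mul_nonneg (hγ s i1) i2.le) (mul_nonneg (hδ s i1) i3.le)

/-- In a cooperative planar linear system with diagonal coefficients at least `-M` a positive
solution decays at most like `exp (-M t)`. -/
lemma exp_mul_le_of_cooperative {X Y α β γ δ : ℝ → ℝ} {a b M : ℝ}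
    (hX : ContinuousOn X (Icc a b)) (hY : ContinuousOn Y (Icc a b))
    (hX' : ∀ t ∈ Ioo a b, HasDerivAt X (α t * X t + β t * Y t) t)
    (hY' : ∀ t ∈ Ioo a b, HasDerivAt Y (γ t * X t + δ t * Y t) t)
    (hα : ∀ t ∈ Ioo a b, -M ≤ α t) (hβ : ∀ t ∈ Ioo a b, 0 ≤ β t)
    (hγ : ∀ t ∈ Ioo a b, 0 ≤ γ t) (hδ : ∀ t ∈ Ioo a b, -M ≤ δ t)
    (hXa : 0 < X a) (hYa : 0 < Y a) :
    ∀ t ∈ Icc a b, Real.exp (-(M * (t - a))) * Y a ≤ Y t := by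
  intro t ht
  have hexp : ∀ t, HasDerivAt (fun t => Real.exp (M * t)) (M * Real.exp (M * t)) t := by
    intro t
    have := ((hasDerivAt_id t).const_mul M).exp
    simpa [mul_comm] using this
  have hec : Continuous fun t => Real.exp (M * t) := by fun_prop
  -- The factor `exp (M t)` adds `M` to both diagonal coefficients and makes them nonnegative.
  have h := (le_of_cooperative_nonneg (X := fun t => Real.exp (M * t) * X t)
    (Y := fun t => Real.exp (M * t) * Y t) (α := fun t => M + α t) (β := β) (γ := γ)
    (δ := fun t => M + δ t) (hec.continuousOn.mul hX) (hec.continuousOn.mul hY)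
    (fun t ht => ((hexp t).mul (hX' t ht)).congr_deriv (by ring))
    (fun t ht => ((hexp t).mul (hY' t ht)).congr_deriv (by ring))
    (fun t ht => by linarith [hα t ht]) hβ hγ (fun t ht => by linarith [hδ t ht])
    (mul_pos (Real.exp_pos _) hXa) (mul_pos (Real.exp_pos _) hYa) t ht).2
  have e : Real.exp (-(M * (t - a))) = Real.exp (-(M * t)) * Real.exp (M * a) := by
    rw [← Real.exp_add]; ring_nf
  have e2 : Real.exp (-(M * t)) * Real.exp (M * t) = 1 := by rw [← Real.exp_add]; simp
  calc _ = Real.exp (-(M * t)) * (Real.exp (M * a) * Y a) := by rw [e]; ring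
    _ ≤ Real.exp (-(M * t)) * (Real.exp (M * t) * Y t) := by gcongr
    _ = Y t := by rw [← mul_assoc, e2, one_mul]

/-! ### A barrier for the linearized equation -/

/-- The quotient of `barrierS` by `sin φ`, as a function of `x = cos φ`. -/
def barrierV (x : ℝ) : ℝ := 4 + 24 * x - 5 * x ^ 2

/-- The first component of the barrier, as a function of `x = cos φ`. -/
noncomputable def barrierF (x : ℝ) : ℝ :=
  (2 * x * barrierV x - (1 - x ^ 2) * (24 - 10 * x)) / (41 / 10)

/-- The second component of the barrier. -/
noncomputable def barrierS (φ : ℝ) : ℝ := Real.sin φ * barrierV (Real.cos φ)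

/-- The derivative of `barrierF`. -/
noncomputable def barrierF' (x : ℝ) : ℝ :=
  (2 * barrierV x + 4 * x * (24 - 10 * x) + 10 * (1 - x ^ 2)) / (41 / 10)

lemma hasDerivAt_barrierV (x : ℝ) : HasDerivAt barrierV (24 - 10 * x) x := by
  unfold barrierV
  refine ((((hasDerivAt_id x).const_mul 24).const_add 4).sub
    ((hasDerivAt_pow 2 x).const_mul 5)).congr_deriv ?_
  norm_num
  ring

lemma hasDerivAt_barrierF (x : ℝ) : HasDerivAt barrierF (barrierF' x) x := by
  unfold barrierF
  refine (((((hasDerivAt_id x).const_mul 2).mul (hasDerivAt_barrierV x)).sub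
    (((hasDerivAt_pow 2 x).const_sub 1).mul
      (((hasDerivAt_id x).const_mul 10).const_sub 24))).div_const (41 / 10)).congr_deriv ?_
  simp [barrierF', barrierV]
  ring

lemma hasDerivAt_barrierF_cos (φ : ℝ) :
    HasDerivAt (fun φ => barrierF (Real.cos φ)) (-(Real.sin φ * barrierF' (Real.cos φ))) φ := by
  refine ((hasDerivAt_barrierF _).comp φ (Real.hasDerivAt_cos φ)).congr_deriv ?_
  ring

lemma hasDerivAt_barrierS {φ : ℝ} (h : Real.sin φ ≠ 0) :
    HasDerivAt barrierS (41 / 10 * barrierF (Real.cos φ) -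
      Real.cos φ / Real.sin φ * barrierS φ) φ := by
  unfold barrierS
  refine ((Real.hasDerivAt_sin φ).mul
    ((hasDerivAt_barrierV _).comp φ (Real.hasDerivAt_cos φ))).congr_deriv ?_
  simp only [barrierF, Function.comp]
  have hs := Real.sin_sq_add_cos_sq φ
  rw [← hs]
  field_simp
  ring

lemma barrierV_bounds {x : ℝ} (h0 : 0 ≤ x) (h1 : x ≤ 1) : 4 ≤ barrierV x ∧ barrierV x ≤ 23 := by
  unfold barrierV
  constructor <;> nlinarith

lemma abs_barrierF_le {x : ℝ} (h0 : 0 ≤ x) (h1 : x ≤ 1) : |barrierF x| ≤ 20 := by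
  obtain ⟨a, b⟩ := barrierV_bounds h0 h1
  have h2 : 0 ≤ 1 - x ^ 2 := by nlinarith
  have h3 : (1 - x ^ 2) * (24 - 10 * x) ≤ 1 * 24 := by
    apply mul_le_mul <;> nlinarith
  have h4 : 0 ≤ (1 - x ^ 2) * (24 - 10 * x) := mul_nonneg h2 (by linarith)
  have h5 : x * barrierV x ≤ 1 * 23 := by apply mul_le_mul <;> linarith
  have h6 : 0 ≤ x * barrierV x := mul_nonneg h0 (by linarith)
  rw [barrierF, abs_le]
  constructor
  · rw [le_div_iff₀ (by norm_num)]; linarith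
  · rw [div_le_iff₀ (by norm_num)]; linarith

lemma barrierF_le {x : ℝ} (h0 : 0 ≤ x) (h1 : x ≤ 1) :
    barrierF x ≤ 2 * x * barrierV x / (41 / 10) := by
  rw [barrierF]
  have h2 : 0 ≤ 1 - x ^ 2 := by nlinarith
  have h4 : 0 ≤ (1 - x ^ 2) * (24 - 10 * x) := mul_nonneg h2 (by linarith)
  gcongr
  linarith

/-- The strict differential inequality of the barrier: with `k = barrierS` and `h` the first
component, it says `h' ≤ -(1 + 1 / 100) k`, whereas `k' = 4.1 h - cot φ * k` holds exactly by the
choice of `barrierF`. Both margins, `1 / 100` here and `4.1` against `4`, absorb the perturbation.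
-/
lemma barrierF'_sub_barrierV {x : ℝ} (h0 : 0 ≤ x) (h1 : x ≤ 1) :
    1 / 100 * barrierV x ≤ barrierF' x - barrierV x := by
  have e : barrierF' x - barrierV x - 1 / 100 * barrierV x =
      (18 + 144 * x - 60 * x ^ 2 - 4141 / 1000 * (4 + 24 * x - 5 * x ^ 2)) / (41 / 10) := by
    simp only [barrierF', barrierV]
    ring
  have : 0 ≤ barrierF' x - barrierV x - 1 / 100 * barrierV x := by
    rw [e]
    apply div_nonneg _ (by norm_num)
    nlinarith
  linarith

/-- The quadratic form that makes the cone over the barrier invariant. -/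
lemma barrier_form_nonneg {h k d e₁ e₂ e₃ e₄ η : ℝ} (hη : η ≤ 1 / 1000) (h1 : |e₁| ≤ η)
    (h2 : |e₂| ≤ η) (h3 : |e₃| ≤ η) (h4 : |e₄| ≤ η) (hk : 0 ≤ k) (hd : 1 / 100 * k ≤ d) :
    0 ≤ (1 / 10 - e₃) * h ^ 2 + e₁ * k * h + k * (d + e₂ * k - e₄ * h) := by
  have a1 := abs_le.1 (h1.trans hη)
  have a2 := abs_le.1 (h2.trans hη)
  have a3 := abs_le.1 (h3.trans hη)
  have a4 := abs_le.1 (h4.trans hη)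
  have b1 : (9 / 100) * h ^ 2 ≤ (1 / 10 - e₃) * h ^ 2 := by gcongr; linarith
  have b2 : 1 / 100 * k ^ 2 ≤ k * d := by nlinarith
  have b3 : -(1 / 1000) * k ^ 2 ≤ e₂ * k ^ 2 := by gcongr; linarith
  have b4 : |(e₁ - e₄) * (k * h)| ≤ 1 / 500 * (|k| * |h|) := by
    rw [abs_mul, abs_mul k]
    gcongr
    rw [abs_le]; constructor <;> linarith
  have b5 := neg_le_of_abs_le b4
  have b6 : |k| * |h| ≤ (|k| ^ 2 + |h| ^ 2) / 2 := by nlinarith [sq_nonneg (|k| - |h|)]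
  rw [sq_abs, sq_abs] at b6
  nlinarith

lemma div_ge_neg_of_abs_le {a b A B : ℝ} (hB : 0 < B) (ha : |a| ≤ A) (hb : B ≤ b) :
    -(A / B) ≤ a / b := by
  have hb0 : 0 < b := hB.trans_le hb
  have h1 : |a / b| ≤ A / B := by
    rw [abs_div, abs_of_pos hb0]
    gcongr
    exact (abs_nonneg a).trans ha
  exact neg_le_of_abs_le h1

/-- A solution of a small perturbation of `F' = -S`, `S' = 4 F - cot φ * S` that lies in the cone
over the barrier at `φ₀` has a second component that stays positive up to `π / 2`. -/
theorem exp_mul_le_of_barrier {F S e₁ e₂ e₃ e₄ : ℝ → ℝ} {φ₀ η : ℝ} (h0 : 0 < φ₀)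
    (hpi : φ₀ ≤ Real.pi / 2) (hη : η ≤ 1 / 1000)
    (hF : ContinuousOn F (Icc φ₀ (Real.pi / 2))) (hS : ContinuousOn S (Icc φ₀ (Real.pi / 2)))
    (hF' : ∀ φ ∈ Ioo φ₀ (Real.pi / 2),
      HasDerivAt F (-S φ + (e₁ φ * F φ + e₂ φ * S φ)) φ)
    (hS' : ∀ φ ∈ Ioo φ₀ (Real.pi / 2), HasDerivAt S
      (4 * F φ + (e₃ φ * F φ + e₄ φ * S φ) - Real.cos φ / Real.sin φ * S φ) φ)
    (h1 : ∀ φ, |e₁ φ| ≤ η) (h2 : ∀ φ, |e₂ φ| ≤ η) (h3 : ∀ φ, |e₃ φ| ≤ η) (h4 : ∀ φ, |e₄ φ| ≤ η)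
    (hW0 : 0 < F φ₀ * barrierS φ₀ - S φ₀ * barrierF (Real.cos φ₀)) (hS0 : 0 < S φ₀) :
    ∀ φ ∈ Icc φ₀ (Real.pi / 2),
      Real.exp (-(40 / Real.sin φ₀ * (φ - φ₀))) * S φ₀ ≤ S φ := by
  have hs0 : 0 < Real.sin φ₀ := Real.sin_pos_of_pos_of_lt_pi h0 (by linarith [Real.pi_pos])
  have hs01 : Real.sin φ₀ ≤ 1 := Real.sin_le_one _
  have hsin : ∀ φ ∈ Ioo φ₀ (Real.pi / 2), Real.sin φ₀ ≤ Real.sin φ := fun φ hφ =>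
    Real.sin_le_sin_of_le_of_le_pi_div_two (by linarith [Real.pi_pos]) hφ.2.le hφ.1.le
  have hcos : ∀ φ ∈ Ioo φ₀ (Real.pi / 2), 0 ≤ Real.cos φ := fun φ hφ =>
    Real.cos_nonneg_of_neg_pi_div_two_le_of_le (by linarith [Real.pi_pos, hφ.1]) hφ.2.le
  have hk : ∀ φ ∈ Ioo φ₀ (Real.pi / 2), 4 * Real.sin φ₀ ≤ barrierS φ := fun φ hφ => by
    have := (barrierV_bounds (hcos φ hφ) (Real.cos_le_one φ)).1
    have h5 := hsin φ hφ
    rw [barrierS, mul_comm 4]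
    exact mul_le_mul h5 this (by norm_num) (hs0.le.trans h5)
  have hcot : ∀ φ ∈ Ioo φ₀ (Real.pi / 2), Real.cos φ / Real.sin φ ≤ 1 / Real.sin φ₀ :=
    fun φ hφ => by
      have h5 := hsin φ hφ
      have h6 := Real.cos_le_one φ
      gcongr
  have hinv : 1 ≤ 1 / Real.sin φ₀ := by rw [le_div_iff₀ hs0]; linarith
  have habs3 : ∀ φ, -(1 / 1000) ≤ e₃ φ ∧ e₃ φ ≤ 1 / 1000 := fun φ =>
    abs_le.1 ((h3 φ).trans hη)
  have hM : 40 / Real.sin φ₀ = 40 * (1 / Real.sin φ₀) := by ring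
  -- With `k` and `h` the components of the barrier, put `W = F k - S h`. Substituting `F = (W + S
  -- h) / k` gives a linear system for `(W, S)` whose off-diagonal coefficients are nonnegative: the
  -- one in `W'` by `barrier_form_nonneg`, the one in `S'` because it is `(4 + e₃) / k`. The
  -- diagonal ones are bounded below since `k ≥ 4 sin φ₀` and `cot φ ≤ 1 / sin φ₀`.
  refine exp_mul_le_of_cooperative
    (X := fun φ => F φ * barrierS φ - S φ * barrierF (Real.cos φ))
    (α := fun φ => ((1 / 10 - e₃ φ) * barrierF (Real.cos φ)) / barrierS φ + e₁ φ -
      Real.cos φ / Real.sin φ)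
    (β := fun φ => ((1 / 10 - e₃ φ) * barrierF (Real.cos φ) ^ 2 +
      e₁ φ * barrierS φ * barrierF (Real.cos φ) +
      barrierS φ * (Real.sin φ * barrierF' (Real.cos φ) - barrierS φ + e₂ φ * barrierS φ -
        e₄ φ * barrierF (Real.cos φ))) / barrierS φ)
    (γ := fun φ => (4 + e₃ φ) / barrierS φ)
    (δ := fun φ => ((4 + e₃ φ) * barrierF (Real.cos φ)) / barrierS φ + e₄ φ -
      Real.cos φ / Real.sin φ)
    ?_ hS ?_ ?_ ?_ ?_ ?_ ?_ hW0 hS0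
  · have c1 : Continuous barrierS := by unfold barrierS barrierV; fun_prop
    have c2 : Continuous fun φ => barrierF (Real.cos φ) := by
      unfold barrierF barrierV; fun_prop
    exact (hF.mul c1.continuousOn).sub (hS.mul c2.continuousOn)
  · intro φ hφ
    have hk0 : barrierS φ ≠ 0 := by linarith [hk φ hφ]
    have hs : Real.sin φ ≠ 0 := by linarith [hsin φ hφ]
    refine (((hF' φ hφ).mul (hasDerivAt_barrierS hs)).sub
      ((hS' φ hφ).mul (hasDerivAt_barrierF_cos φ))).congr_deriv ?_
    field_simp
    ring
  · intro φ hφ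
    have hk0 : barrierS φ ≠ 0 := by linarith [hk φ hφ]
    refine (hS' φ hφ).congr_deriv ?_
    field_simp
    ring
  · intro φ hφ
    have d1 : |(1 / 10 - e₃ φ) * barrierF (Real.cos φ)| ≤ 1 * 20 := by
      rw [abs_mul]
      gcongr
      · rw [abs_le]; constructor <;> linarith [(habs3 φ).1, (habs3 φ).2]
      · exact abs_barrierF_le (hcos φ hφ) (Real.cos_le_one φ)
    have d2 := div_ge_neg_of_abs_le (by positivity) d1 (hk φ hφ)
    have d3 : 1 * 20 / (4 * Real.sin φ₀) = 5 * (1 / Real.sin φ₀) := by field_simp; norm_num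
    have d4 := neg_le_of_abs_le (h1 φ)
    rw [d3] at d2
    rw [hM]
    linarith [hcot φ hφ]
  · intro φ hφ
    have hk0 : 0 < barrierS φ := by linarith [hk φ hφ]
    apply div_nonneg _ hk0.le
    apply barrier_form_nonneg hη (h1 φ) (h2 φ) (h3 φ) (h4 φ) hk0.le
    have := barrierF'_sub_barrierV (hcos φ hφ) (Real.cos_le_one φ)
    have hs := hs0.trans_le (hsin φ hφ)
    rw [barrierS]
    nlinarith
  · intro φ hφ
    exact div_nonneg (by linarith [(habs3 φ).1]) (by linarith [hk φ hφ])
  · intro φ hφ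
    have d1 : |(4 + e₃ φ) * barrierF (Real.cos φ)| ≤ 5 * 20 := by
      rw [abs_mul]
      gcongr
      · rw [abs_le]; constructor <;> linarith [(habs3 φ).1, (habs3 φ).2]
      · exact abs_barrierF_le (hcos φ hφ) (Real.cos_le_one φ)
    have d2 := div_ge_neg_of_abs_le (by positivity) d1 (hk φ hφ)
    have d3 : 5 * 20 / (4 * Real.sin φ₀) = 25 * (1 / Real.sin φ₀) := by field_simp; norm_num
    have d4 := neg_le_of_abs_le (h4 φ)
    rw [d3] at d2
    rw [hM]
    linarith [hcot φ hφ]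

/-- The whole error is charged to the larger of the two variables. In this way the nonlinear
remainder becomes a small perturbation of the coefficients of a linear system. -/
lemma exists_coeff_of_abs_le_max {err F S η : ℝ} (hη : 0 ≤ η) (h : |err| ≤ η * max |F| |S|) :
    ∃ e e' : ℝ, |e| ≤ η ∧ |e'| ≤ η ∧ err = e * F + e' * S := by
  have key : ∀ G : ℝ, |err| ≤ η * |G| → |err / G| ≤ η ∧ err = err / G * G := by
    intro G hG
    rcases eq_or_ne G 0 with rfl | h0
    · have : err = 0 := by simpa using hG
      simp [this, hη]
    · refine ⟨?_, by field_simp⟩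
      rw [abs_div, div_le_iff₀ (abs_pos.2 h0)]
      exact hG
  rcases le_total |F| |S| with h1 | h1
  · rw [max_eq_right h1] at h
    exact ⟨0, err / S, by simpa using hη, (key S h).1, by simpa using (key S h).2⟩
  · rw [max_eq_left h1] at h
    exact ⟨err / F, 0, (key F h).1, by simpa using hη, by simpa using (key F h).2⟩

/-- Near the axis a solution of the perturbed linear system is inside the cone over the barrier. -/
lemma barrier_initial {F S : ℝ → ℝ} {e₃ e₄ : ℝ → ℝ} {φ₀ F₀ : ℝ} (h0 : 0 < φ₀)
    (hpi : φ₀ ≤ Real.pi / 2) (hF₀ : 0 < F₀) (hS : ContinuousOn S (Icc 0 φ₀))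
    (hS' : ∀ φ ∈ Ioo 0 φ₀, HasDerivAt S
      (4 * F φ + (e₃ φ * F φ + e₄ φ * S φ) - Real.cos φ / Real.sin φ * S φ) φ)
    (hFb : |F φ₀ - F₀| ≤ 1 / 1000 * F₀)
    (hb : ∀ φ ∈ Ioo 0 φ₀, |4 * F φ + (e₃ φ * F φ + e₄ φ * S φ) - 4 * F₀| ≤ 1 / 1000 * F₀) :
    3 * (1 - Real.cos φ₀) * F₀ ≤ S φ₀ ∧
      0 < F φ₀ * barrierS φ₀ - S φ₀ * barrierF (Real.cos φ₀) := by
  have hs0 : 0 < Real.sin φ₀ := Real.sin_pos_of_pos_of_lt_pi h0 (by linarith [Real.pi_pos])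
  have hs1 := Real.sin_le_one φ₀
  have hc0 : 0 ≤ Real.cos φ₀ :=
    Real.cos_nonneg_of_neg_pi_div_two_le_of_le (by linarith [Real.pi_pos]) hpi
  have hsc := Real.sin_sq_add_cos_sq φ₀
  have hc1 : Real.cos φ₀ < 1 := by nlinarith
  have hpos : ∀ φ ∈ Ioo 0 φ₀, 0 < Real.sin φ := fun φ hφ =>
    Real.sin_pos_of_pos_of_lt_pi hφ.1 (by linarith [Real.pi_pos, hφ.2])
  have hd : ∀ φ ∈ Ioo 0 φ₀, HasDerivAt (fun φ => Real.sin φ * S φ)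
      (Real.sin φ * (4 * F φ + (e₃ φ * F φ + e₄ φ * S φ))) φ := fun φ hφ => by
    have := (hpos φ hφ).ne'
    refine ((Real.hasDerivAt_sin φ).mul (hS' φ hφ)).congr_deriv ?_
    field_simp
    ring
  have hcS : ContinuousOn (fun φ => Real.sin φ * S φ) (Icc 0 φ₀) :=
    Real.continuous_sin.continuousOn.mul hS
  have hdc : ∀ a φ, HasDerivAt (fun φ => a * (1 - Real.cos φ)) (a * Real.sin φ) φ := fun a φ => by
    refine (((Real.hasDerivAt_cos φ).const_sub 1).const_mul a).congr_deriv ?_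
    ring
  have hcc : ∀ a, ContinuousOn (fun φ => a * (1 - Real.cos φ)) (Icc 0 φ₀) := fun a => by fun_prop
  -- As `(sin φ * S)'` is `sin φ` times a quantity close to `4 F₀`, the product `sin φ * S` lies
  -- between the multiples `3.999 F₀` and `4.001 F₀` of `1 - cos φ`.
  have hlow := le_of_hasDerivAt_nonneg_Ioo
    (u := fun φ => Real.sin φ * S φ - (3999 / 1000 * F₀) * (1 - Real.cos φ)) h0.le
    (hcS.sub (hcc _)) (fun φ hφ => (hd φ hφ).sub (hdc _ φ)) (fun φ hφ => by
      have := (abs_le.1 (hb φ hφ)).1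
      nlinarith [hpos φ hφ])
  have hupp := le_of_hasDerivAt_nonneg_Ioo
    (u := fun φ => (4001 / 1000 * F₀) * (1 - Real.cos φ) - Real.sin φ * S φ) h0.le
    ((hcc _).sub hcS) (fun φ hφ => (hdc _ φ).sub (hd φ hφ)) (fun φ hφ => by
      have := (abs_le.1 (hb φ hφ)).2
      nlinarith [hpos φ hφ])
  simp only [Real.sin_zero, Real.cos_zero, sub_self, mul_zero, zero_mul, sub_nonneg] at hlow hupp
  set x := Real.cos φ₀
  set s := Real.sin φ₀
  have h1x : 0 < F₀ * (1 - x) := mul_pos hF₀ (by linarith)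
  have hS0 : 0 < S φ₀ := by
    by_contra hneg
    nlinarith [mul_nonneg hs0.le (neg_nonneg.2 (not_lt.1 hneg))]
  refine ⟨by nlinarith, ?_⟩
  have hv := (barrierV_bounds hc0 hc1.le).1
  have hFlow : 999 / 1000 * F₀ ≤ F φ₀ := by linarith [(abs_le.1 hFb).1]
  have a1 : S φ₀ * barrierF x ≤ S φ₀ * (2 * x * barrierV x / (41 / 10)) :=
    mul_le_mul_of_nonneg_left (barrierF_le hc0 hc1.le) hS0.le
  have a2 : (s * S φ₀) * (2 * x * barrierV x / (41 / 10)) ≤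
      (4001 / 1000 * F₀ * (1 - x)) * (2 * x * barrierV x / (41 / 10)) := by
    apply mul_le_mul_of_nonneg_right hupp
    positivity
  have a3 : 999 / 1000 * F₀ * (s ^ 2 * barrierV x) ≤ F φ₀ * (s ^ 2 * barrierV x) := by gcongr
  have hss : s ^ 2 = (1 - x) * (1 + x) := by linear_combination hsc
  -- This is where `4.1 > 4` enters: as `x → 1` the last factor compares `2` with `2 * 4 / 4.1`.
  have a4 : 0 < (F₀ * (1 - x)) * barrierV x *
      (999 / 1000 * (1 + x) - 4001 / 1000 * (2 * x / (41 / 10))) := by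
    apply mul_pos (mul_pos h1x (by linarith))
    rw [show 999 / 1000 * (1 + x) - 4001 / 1000 * (2 * x / (41 / 10)) =
      999 / 1000 - (8002 / 4100 - 999 / 1000) * x by ring]
    nlinarith
  have a5 : 0 < s * (F φ₀ * barrierS φ₀ - S φ₀ * barrierF x) := by
    have e : s * (F φ₀ * barrierS φ₀ - S φ₀ * barrierF x) =
      F φ₀ * (s ^ 2 * barrierV x) - s * (S φ₀ * barrierF x) := by
      simp only [barrierS, x, s]; ring
    have a6 := mul_le_mul_of_nonneg_left a1 hs0.le
    rw [hss] at a3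
    rw [e, hss]
    linarith
  exact (mul_pos_iff_of_pos_left hs0).1 a5

/-! ### Growth of the second component with the initial value -/

/-- If `V` has strict derivative `(f, σ) ↦ (-σ, 4 f)` at the origin, then along a Lipschitz family
of small solutions the second component grows at a definite rate with the initial value. -/
theorem exists_slope_lower_bound {V : ℝ × ℝ → ℝ × ℝ} (hVc : Continuous V)
    {A : ℝ × ℝ →L[ℝ] ℝ × ℝ} (hVA : HasStrictFDerivAt V A 0) (hA : ∀ p, A p = (-p.2, 4 * p.1))
    {L : ℝ} (hL : 0 < L) {x : ℝ → ℝ → ℝ × ℝ} (hx : ∀ y, IsPolarSolution V y (x y))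
    (hx0 : ∀ φ, x 0 φ = 0) (hxL : ∀ y y' φ, ‖x y φ - x y' φ‖ ≤ L * |y - y'|) :
    ∃ κ > 0, ∃ δ > 0, ∀ y y', |y| < δ → |y'| < δ → y < y' →
      ∀ φ ∈ Icc (Real.pi / 4) (Real.pi / 2), κ * (y' - y) ≤ (x y' φ).2 - (x y φ).2 := by
  -- This number serves twice: as the angle at which the comparison starts and as the bound for the
  -- coefficient errors. The factor `L + 1` keeps the errors, of size `φ₀ L (y' - y)`, and the drift
  -- of `F` on `[0, φ₀]` small against `y' - y`.
  set φ₀ : ℝ := 1 / (10000 * (L + 1)) with hφ₀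
  have hφ₀0 : 0 < φ₀ := by positivity
  have hφ₀L : φ₀ * (L + 1) = 1 / 10000 := by rw [hφ₀]; field_simp
  have hφ₀1 : φ₀ ≤ 1 / 10000 := by nlinarith
  have hpi3 := Real.pi_gt_three
  have hφ₀pi : φ₀ ≤ Real.pi / 4 := by linarith
  obtain ⟨ρ, hρ, hVρ⟩ : ∃ ρ > 0, ∀ p q : ℝ × ℝ, ‖p‖ < ρ → ‖q‖ < ρ →
      ‖V p - V q - A (p - q)‖ ≤ φ₀ * ‖p - q‖ := by
    have h1 := hVA.isLittleO.def hφ₀0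
    rw [show ((0 : ℝ × ℝ), (0 : ℝ × ℝ)) = 0 from rfl, Metric.eventually_nhds_iff] at h1
    obtain ⟨ρ, hρ, h1⟩ := h1
    refine ⟨ρ, hρ, fun p q hp hq => ?_⟩
    have := @h1 (p, q) (by rw [dist_zero_right]; exact max_lt hp hq)
    exact this
  have hc1 : Real.cos φ₀ < 1 := by
    have := Real.cos_lt_cos_of_nonneg_of_le_pi le_rfl (by linarith) hφ₀0
    rwa [Real.cos_zero] at this
  refine ⟨Real.exp (-(40 / Real.sin φ₀ * (Real.pi / 2))) * (3 * (1 - Real.cos φ₀)),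
    mul_pos (Real.exp_pos _) (by linarith), ρ / L, by positivity, ?_⟩
  intro y y' hy hy' hyy φ hφ
  have hsmall : ∀ {u}, |u| < ρ / L → ∀ φ, ‖x u φ‖ < ρ := by
    intro u hu φ
    have := hxL u 0 φ
    rw [hx0, sub_zero, sub_zero] at this
    rw [lt_div_iff₀ hL] at hu
    linarith
  set F : ℝ → ℝ := fun φ => (x y' φ).1 - (x y φ).1 with hF
  set S : ℝ → ℝ := fun φ => (x y' φ).2 - (x y φ).2 with hS
  have hF₀ : 0 < y' - y := by linarith
  have hb : ∀ φ, ‖x y' φ - x y φ‖ ≤ L * (y' - y) := fun φ => by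
    simpa only [abs_of_pos hF₀] using hxL y' y φ
  have hFb : ∀ φ, |F φ| ≤ L * (y' - y) := fun φ => (norm_fst_le _).trans (hb φ)
  have hSb : ∀ φ, |S φ| ≤ L * (y' - y) := fun φ => (norm_snd_le _).trans (hb φ)
  have herr : ∀ φ, ‖V (x y' φ) - V (x y φ) - A (x y' φ - x y φ)‖ ≤ φ₀ * max |F φ| |S φ| :=
    fun φ => hVρ _ _ (hsmall hy' φ) (hsmall hy φ)
  have hex1 : ∀ φ, ∃ e e' : ℝ, |e| ≤ φ₀ ∧ |e'| ≤ φ₀ ∧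
      (V (x y' φ)).1 - (V (x y φ)).1 = -S φ + (e * F φ + e' * S φ) := by
    intro φ
    obtain ⟨e, e', h1, h2, h3⟩ := exists_coeff_of_abs_le_max hφ₀0.le
      ((norm_fst_le _).trans (herr φ))
    refine ⟨e, e', h1, h2, ?_⟩
    rw [hA] at h3
    simp only [Prod.fst_sub, Prod.snd_sub] at h3
    linarith
  have hex2 : ∀ φ, ∃ e e' : ℝ, |e| ≤ φ₀ ∧ |e'| ≤ φ₀ ∧
      (V (x y' φ)).2 - (V (x y φ)).2 = 4 * F φ + (e * F φ + e' * S φ) := by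
    intro φ
    obtain ⟨e, e', h1, h2, h3⟩ := exists_coeff_of_abs_le_max hφ₀0.le
      ((norm_snd_le _).trans (herr φ))
    refine ⟨e, e', h1, h2, ?_⟩
    rw [hA] at h3
    simp only [Prod.fst_sub, Prod.snd_sub] at h3
    linarith
  choose e₁ e₂ he₁ he₂ hE1 using hex1
  choose e₃ e₄ he₃ he₄ hE2 using hex2
  have hFc : Continuous F := (hx y').continuous.fst.sub (hx y).continuous.fst
  have hSc : Continuous S := (hx y').continuous.snd.sub (hx y).continuous.snd
  have hF' : ∀ φ ∈ Ioo 0 (Real.pi / 2), HasDerivAt F (-S φ + (e₁ φ * F φ + e₂ φ * S φ)) φ := by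
    intro φ hφ
    exact (((hx y').hasDerivAt_fst hVc hφ).sub ((hx y).hasDerivAt_fst hVc hφ)).congr_deriv (hE1 φ)
  have hS' : ∀ φ ∈ Ioo 0 (Real.pi / 2), HasDerivAt S
      (4 * F φ + (e₃ φ * F φ + e₄ φ * S φ) - Real.cos φ / Real.sin φ * S φ) φ := by
    intro φ hφ
    refine (((hx y').hasDerivAt_snd hVc hφ).sub ((hx y).hasDerivAt_snd hVc hφ)).congr_deriv ?_
    rw [← hE2 φ, hS]
    ring
  have hlin : ∀ {e e' : ℝ}, |e| ≤ φ₀ → |e'| ≤ φ₀ → ∀ φ,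
      |e * F φ + e' * S φ| ≤ 1 / 5000 * (y' - y) := by
    intro e e' he he' φ
    refine (abs_add_le _ _).trans ?_
    rw [abs_mul, abs_mul]
    have c1 : |e| * |F φ| ≤ φ₀ * (L * (y' - y)) :=
      mul_le_mul he (hFb φ) (abs_nonneg _) hφ₀0.le
    have c2 : |e'| * |S φ| ≤ φ₀ * (L * (y' - y)) :=
      mul_le_mul he' (hSb φ) (abs_nonneg _) hφ₀0.le
    have c3 : φ₀ * L * (y' - y) ≤ 1 / 10000 * (y' - y) := by gcongr; linarith
    linarith
  have hFd : ∀ φ ∈ Icc 0 φ₀, |F φ - (y' - y)| ≤ 1 / 5000 * (y' - y) := by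
    intro φ hφ
    have hI : ∀ s ∈ Ioo 0 φ, s ∈ Ioo 0 (Real.pi / 2) := fun s hs =>
      ⟨hs.1, by linarith [hs.2, hφ.2]⟩
    have h1 := abs_sub_le_of_hasDerivAt_Ioo hφ.1 hFc.continuousOn (fun s hs => hF' s (hI s hs))
      (C := (L + 1) * (y' - y)) (fun s hs => by
        refine (abs_add_le _ _).trans ?_
        rw [abs_neg]
        have := hlin (he₁ s) (he₂ s) s
        linarith [hSb s])
    have h2 : F 0 = y' - y := by simp only [hF, (hx y').fst_zero, (hx y).fst_zero]
    rw [h2, sub_zero] at h1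
    have h3 : φ * ((L + 1) * (y' - y)) ≤ φ₀ * ((L + 1) * (y' - y)) := by
      have := hφ.2
      gcongr
    rw [← mul_assoc φ₀, hφ₀L] at h3
    linarith
  obtain ⟨hSlow, hW⟩ := barrier_initial hφ₀0 (by linarith) hF₀ hSc.continuousOn
    (fun s hs => hS' s ⟨hs.1, by linarith [hs.2]⟩)
    ((hFd φ₀ ⟨hφ₀0.le, le_rfl⟩).trans (by linarith)) (fun s hs => by
      have h1 := abs_le.1 (hFd s ⟨hs.1.le, hs.2.le⟩)
      have h2 := abs_le.1 (hlin (he₃ s) (he₄ s) s)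
      rw [abs_le]
      constructor <;> linarith [h1.1, h1.2, h2.1, h2.2])
  have hSpos : 0 < S φ₀ := lt_of_lt_of_le (mul_pos (by linarith) hF₀) hSlow
  have hfin := exp_mul_le_of_barrier hφ₀0 (by linarith) (by linarith) hFc.continuousOn
    hSc.continuousOn (fun s hs => hF' s ⟨hφ₀0.trans hs.1, hs.2⟩)
    (fun s hs => hS' s ⟨hφ₀0.trans hs.1, hs.2⟩) he₁ he₂ he₃ he₄ hW hSpos φ
    ⟨by linarith [hφ.1], hφ.2⟩
  have hs0 : 0 < Real.sin φ₀ := Real.sin_pos_of_pos_of_lt_pi hφ₀0 (by linarith)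
  calc _ = Real.exp (-(40 / Real.sin φ₀ * (Real.pi / 2))) *
        (3 * (1 - Real.cos φ₀) * (y' - y)) := by ring
    _ ≤ Real.exp (-(40 / Real.sin φ₀ * (φ - φ₀))) * S φ₀ := by
        have : φ - φ₀ ≤ Real.pi / 2 := by linarith [hφ.2]
        have h1c : 0 ≤ 3 * (1 - Real.cos φ₀) * (y' - y) := mul_nonneg (by linarith) hF₀.le
        gcongr
    _ ≤ _ := hfin

/-! ### Profile curves near the sphere in polar coordinates -/

/-- The regular part of the profile-curve system in polar coordinates `ρ = √2 * exp f`, `φ`, where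
`σ` is the sine of the angle between the curve and the circles about the origin. -/
noncomputable def polarField (p : ℝ × ℝ) : ℝ × ℝ :=
  (-(p.2 / Real.sqrt (1 - p.2 ^ 2)), Real.sqrt (1 - p.2 ^ 2) * (2 * (Real.exp (2 * p.1) - 1)))

lemma contDiffAt_polarField_zero : ContDiffAt ℝ 1 polarField 0 := by
  have h : ContDiffAt ℝ 1 (fun p : ℝ × ℝ => Real.sqrt (1 - p.2 ^ 2)) 0 :=
    ContDiffAt.sqrt (by fun_prop) (by norm_num)
  unfold polarField
  refine ContDiffAt.prodMk (ContDiffAt.neg (ContDiffAt.div (by fun_prop) h (by norm_num))) ?_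
  exact h.mul (by fun_prop)

/-- Strictness matters: the derivative has to control the difference of two nearby solutions, not
only the deviation of one from the sphere. -/
lemma hasStrictFDerivAt_polarField_zero :
    HasStrictFDerivAt polarField
      ((-ContinuousLinearMap.snd ℝ ℝ ℝ).prod ((4 : ℝ) • ContinuousLinearMap.fst ℝ ℝ ℝ)) 0 := by
  have hw : HasStrictDerivAt (fun s : ℝ => Real.sqrt (1 - s ^ 2)) 0 0 := by
    have h1 : HasStrictDerivAt (fun s : ℝ => 1 - s ^ 2) 0 0 := by
      simpa using (hasStrictDerivAt_pow 2 (0 : ℝ)).const_sub 1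
    simpa using h1.sqrt (by norm_num)
  have hE : HasStrictDerivAt (fun s : ℝ => -(s / Real.sqrt (1 - s ^ 2))) (-1) 0 := by
    exact ((hasStrictDerivAt_id (0 : ℝ)).div hw (by norm_num)).neg.congr_deriv (by norm_num)
  have hG : HasStrictDerivAt (fun f : ℝ => 2 * (Real.exp (2 * f) - 1)) 4 0 := by
    have h := ((hasStrictDerivAt_id (0 : ℝ)).const_mul 2).exp.sub_const 1
    exact (HasStrictDerivAt.const_mul 2 h).congr_deriv (by norm_num)
  have hfst := hasStrictFDerivAt_fst (𝕜 := ℝ) (E := ℝ) (F := ℝ) (p := 0)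
  have hsnd := hasStrictFDerivAt_snd (𝕜 := ℝ) (E := ℝ) (F := ℝ) (p := 0)
  have h1 := HasStrictDerivAt.comp_hasStrictFDerivAt (0 : ℝ × ℝ) hE hsnd
  have h2 := (HasStrictDerivAt.comp_hasStrictFDerivAt (0 : ℝ × ℝ) hw hsnd).mul
    (HasStrictDerivAt.comp_hasStrictFDerivAt (0 : ℝ × ℝ) hG hfst)
  refine (h1.prodMk h2).congr_fderiv ?_
  ext <;> simp

/-- `x = (f, σ)` describes a profile curve close to the sphere of radius `√2`, in polar
coordinates. -/
structure IsPolarProfile (y : ℝ) (x : ℝ → ℝ × ℝ) : Prop where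
  continuous : Continuous x
  zero : x 0 = (y, 0)
  norm_le : ∀ φ, ‖x φ‖ ≤ 1 / 100
  deriv_fst : ∀ φ ∈ Ioo 0 (Real.pi / 2),
    HasDerivAt (fun φ => (x φ).1) (-((x φ).2 / Real.sqrt (1 - (x φ).2 ^ 2))) φ
  deriv_snd : ∀ φ ∈ Ioo 0 (Real.pi / 2), HasDerivAt (fun φ => (x φ).2)
    (Real.sqrt (1 - (x φ).2 ^ 2) * (2 * (Real.exp (2 * (x φ).1) - 1)) -
      Real.cos φ / Real.sin φ * (x φ).2) φ

/-- Profile curves close to the sphere exist, depend Lipschitz continuously on the starting point,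
and their angles at a fixed polar angle near the equator increase at a definite rate. -/
theorem exists_polarProfile_family :
    ∃ L > 0, ∃ κ > 0, ∃ δ > 0, ∃ x : ℝ → ℝ → ℝ × ℝ,
      (∀ y, |y| < δ → IsPolarProfile y (x y)) ∧ (∀ φ, x 0 φ = 0) ∧
      (∀ y y' φ, ‖x y φ - x y' φ‖ ≤ L * |y - y'|) ∧
      ∀ y y', |y| < δ → |y'| < δ → y < y' →
        ∀ φ ∈ Icc (Real.pi / 4) (Real.pi / 2), κ * (y' - y) ≤ (x y' φ).2 - (x y φ).2 := by
  -- The field is used only near the origin. There it is Lipschitz, so it has a globally Lipschitz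
  -- extension `V`; solutions with small initial value stay where the two agree.
  obtain ⟨K, s, hs, hK⟩ := contDiffAt_polarField_zero.exists_lipschitzOnWith
  obtain ⟨V, hV, hVs⟩ := hK.extend_finite_dimension
  have hVev : polarField =ᶠ[𝓝 0] V := eventually_of_mem hs hVs
  have hV0 : V 0 = 0 := by
    rw [← hVev.self_of_nhds]
    simp [polarField]
  have hVA := hasStrictFDerivAt_polarField_zero.congr_of_eventuallyEq hVev
  obtain ⟨L, x, hL, hx, hx0, hxL⟩ := exists_polarSolution_family hV hV0
  obtain ⟨κ, hκ, δ, hδ, hslope⟩ := exists_slope_lower_bound hV.continuous hVA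
    (fun p => by ext <;> simp) hL hx hx0 hxL
  obtain ⟨ρ, hρ, hball⟩ := Metric.eventually_nhds_iff.1 hVev
  refine ⟨L, hL, κ, hκ, min δ (min (1 / 100) (ρ / 2) / L), by positivity, x, ?_, hx0, hxL, ?_⟩
  · intro y hy
    have hsmall : ∀ φ, ‖x y φ‖ ≤ min (1 / 100) (ρ / 2) := by
      intro φ
      have h1 := hxL y 0 φ
      rw [hx0, sub_zero, sub_zero] at h1
      have h2 := hy.trans_le (min_le_right _ _)
      rw [lt_div_iff₀ hL] at h2
      linarith
    have hVeq : ∀ φ, polarField (x y φ) = V (x y φ) := fun φ => hball (by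
      rw [dist_zero_right]
      have := (hsmall φ).trans (min_le_right _ _)
      linarith)
    refine ⟨(hx y).continuous, Prod.ext (hx y).fst_zero (hx y).snd_zero,
      fun φ => (hsmall φ).trans (min_le_left _ _), fun φ hφ => ?_, fun φ hφ => ?_⟩
    · exact ((hx y).hasDerivAt_fst hV.continuous hφ).congr_deriv (by rw [← hVeq]; rfl)
    · exact ((hx y).hasDerivAt_snd hV.continuous hφ).congr_deriv (by rw [← hVeq]; rfl)
  · exact fun y y' hy hy' => hslope y y' (hy.trans_le (min_le_left _ _))
      (hy'.trans_le (min_le_left _ _))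

/-! ### From polar profiles to orbits parametrized by arclength -/

/-- Inverting `φ ↦ ∫ v` gives a change of parameter with derivative `1 / v`. -/
lemma exists_time_change {v : ℝ → ℝ} (hv : Continuous v) {m : ℝ} (hm : 0 < m) (hmv : ∀ φ, m ≤ v φ) :
    ∃ Φ : ℝ → ℝ, StrictMono Φ ∧ Function.Surjective Φ ∧ Φ 0 = 0 ∧
      ∀ t, HasDerivAt Φ (v (Φ t))⁻¹ t := by
  set τ : ℝ → ℝ := fun φ => ∫ s in (0 : ℝ)..φ, v s with hτ
  have hd : ∀ φ, HasDerivAt τ (v φ) φ := fun φ =>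
    intervalIntegral.integral_hasDerivAt_right (hv.intervalIntegrable _ _)
      (hv.stronglyMeasurableAtFilter _ _) hv.continuousAt
  have hpos : ∀ φ, 0 < v φ := fun φ => hm.trans_le (hmv φ)
  have hmono : StrictMono τ := strictMono_of_hasDerivAt_pos hd hpos
  have hcont : Continuous τ := continuous_iff_continuousAt.2 fun φ => (hd φ).continuousAt
  have hτ0 : τ 0 = 0 := by simp [hτ]
  have hlin : Monotone fun φ => τ φ - m * φ := by
    apply monotone_of_hasDerivAt_nonneg (f' := fun φ => v φ - m)
    · intro φ
      exact ((hd φ).sub ((hasDerivAt_id φ).const_mul m)).congr_deriv (by simp)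
    · intro φ
      simpa using hmv φ
  have hsurj : Function.Surjective τ := by
    apply hcont.surjective
    · apply tendsto_atTop_mono' atTop _ (tendsto_id.const_mul_atTop hm)
      filter_upwards [eventually_ge_atTop 0] with φ hφ
      have := hlin hφ
      simp only [hτ0, mul_zero, sub_zero] at this
      simpa using this
    · apply tendsto_atBot_mono' atBot _ (tendsto_id.const_mul_atBot hm)
      filter_upwards [eventually_le_atBot 0] with φ hφ
      have := hlin hφ
      simp only [hτ0, mul_zero, sub_zero] at this
      simpa using this
  set e := hmono.orderIsoOfSurjective τ hsurj with he
  have hτe : ∀ t, τ (e.symm t) = t := fun t => e.apply_symm_apply t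
  refine ⟨e.symm, e.symm.strictMono, e.symm.surjective, hmono.injective ?_, fun t => ?_⟩
  · rw [hτe, hτ0]
  · exact HasDerivAt.of_local_left_inverse e.symm.continuous.continuousAt (hd _)
      (hpos _).ne' (Eventually.of_forall hτe)

namespace IsPolarProfile

variable {y : ℝ} {x : ℝ → ℝ × ℝ}

lemma abs_fst_le (h : IsPolarProfile y x) (φ : ℝ) : |(x φ).1| ≤ 1 / 100 :=
  (norm_fst_le _).trans (h.norm_le φ)

lemma abs_snd_le (h : IsPolarProfile y x) (φ : ℝ) : |(x φ).2| ≤ 1 / 100 :=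
  (norm_snd_le _).trans (h.norm_le φ)

lemma sqrt_bounds (h : IsPolarProfile y x) (φ : ℝ) :
    99 / 100 ≤ Real.sqrt (1 - (x φ).2 ^ 2) ∧ Real.sqrt (1 - (x φ).2 ^ 2) ≤ 1 := by
  have h1 := abs_le.1 (h.abs_snd_le φ)
  constructor
  · apply Real.le_sqrt_of_sq_le
    nlinarith [h1.1, h1.2]
  · exact Real.sqrt_le_one.2 (by nlinarith)

lemma exp_bounds (h : IsPolarProfile y x) (φ : ℝ) :
    99 / 100 ≤ Real.exp (x φ).1 ∧ Real.exp (x φ).1 ≤ 51 / 50 := by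
  have h1 := abs_le.1 (h.abs_fst_le φ)
  constructor
  · linarith [Real.add_one_le_exp (x φ).1, h1.1]
  · have h2 := Real.add_one_le_exp (-(x φ).1)
    rw [Real.exp_neg] at h2
    have h3 := Real.exp_pos (x φ).1
    have h4 : (99 / 100) * Real.exp (x φ).1 ≤ 1 := by
      have h5 : 99 / 100 ≤ (Real.exp (x φ).1)⁻¹ := by linarith [h1.2]
      calc _ ≤ (Real.exp (x φ).1)⁻¹ * Real.exp (x φ).1 := by gcongr
        _ = 1 := inv_mul_cancel₀ h3.ne'
    linarith

/-- A profile curve in polar coordinates gives an orbit that reaches the `r`-axis. The function `Φ`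
is the polar angle along the orbit. -/
theorem exists_isCapOrbit (h : IsPolarProfile y x) :
    ∃ (Φ : ℝ → ℝ) (T : ℝ), StrictMono Φ ∧ Function.Surjective Φ ∧ Φ 0 = 0 ∧ Φ T = Real.pi / 2 ∧
      IsCapOrbit (Real.sqrt 2 * Real.exp y) T
        (fun t => Real.sqrt 2 * Real.exp (x (Φ t)).1 * Real.cos (Φ t))
        (fun t => Real.sqrt 2 * Real.exp (x (Φ t)).1 * Real.sin (Φ t))
        (fun t => Φ t + Real.pi / 2 + Real.arcsin (x (Φ t)).2) := by
  have h2 : 0 < Real.sqrt 2 := by positivity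
  have hw : ∀ φ, 0 < Real.sqrt (1 - (x φ).2 ^ 2) := fun φ => by linarith [(h.sqrt_bounds φ).1]
  have hc1 : Continuous fun φ => (x φ).1 := h.continuous.fst
  have hc2 : Continuous fun φ => (x φ).2 := h.continuous.snd
  -- The integrand is the arclength element `ρ / √(1 - σ²)` per unit of polar angle.
  obtain ⟨Φ, hmono, hsurj, hΦ0, hΦd⟩ := exists_time_change
    (v := fun φ => Real.sqrt 2 * Real.exp (x φ).1 / Real.sqrt (1 - (x φ).2 ^ 2))
    (Continuous.div (by fun_prop) (by fun_prop) fun φ => (hw φ).ne')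
    (m := Real.sqrt 2 * (99 / 100)) (by positivity) (fun φ => by
      rw [le_div_iff₀ (hw φ)]
      have e1 := (h.exp_bounds φ).1
      calc _ ≤ Real.sqrt 2 * Real.exp (x φ).1 * 1 := by
            gcongr
            exact (h.sqrt_bounds φ).2
        _ = _ := mul_one _)
  obtain ⟨T, hT⟩ := hsurj (Real.pi / 2)
  have hT0 : 0 < T := by
    rw [← hmono.lt_iff_lt, hΦ0, hT]
    positivity
  have hΦc : Continuous Φ := continuous_iff_continuousAt.2 fun t => (hΦd t).continuousAt
  have hΦI : ∀ t ∈ Ioo 0 T, Φ t ∈ Ioo 0 (Real.pi / 2) := fun t ht => by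
    rw [← hT, ← hΦ0]
    exact ⟨hmono ht.1, hmono ht.2⟩
  have hx1 : Continuous fun t => (x (Φ t)).1 := hc1.comp hΦc
  have hx2 : Continuous fun t => (x (Φ t)).2 := hc2.comp hΦc
  have hsin : ∀ t ∈ Ioc 0 T, 0 < Real.sin (Φ t) := fun t ht => by
    have a1 := hmono ht.1
    have a2 := hmono.monotone ht.2
    rw [hΦ0] at a1
    rw [hT] at a2
    exact Real.sin_pos_of_pos_of_lt_pi a1 (by linarith [Real.pi_pos])
  have hdf : ∀ t ∈ Ioo 0 T, HasDerivAt (fun t => Real.sqrt 2 * Real.exp (x (Φ t)).1)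
      (-(x (Φ t)).2) t := fun t ht => by
    have := (hw (Φ t)).ne'
    have hexp := (Real.exp_pos (x (Φ t)).1).ne'
    refine (((h.deriv_fst _ (hΦI t ht)).comp t (hΦd t)).exp.const_mul (Real.sqrt 2)).congr_deriv ?_
    simp only [Function.comp]
    field_simp
  have hcosθ : ∀ t, Real.cos (Φ t + Real.pi / 2 + Real.arcsin (x (Φ t)).2) =
      -(Real.sin (Φ t) * Real.sqrt (1 - (x (Φ t)).2 ^ 2) + Real.cos (Φ t) * (x (Φ t)).2) := by
    intro t
    have a := abs_le.1 (h.abs_snd_le (Φ t))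
    rw [add_right_comm, Real.cos_add_pi_div_two, Real.sin_add, Real.cos_arcsin,
      Real.sin_arcsin (by linarith) (by linarith)]
  have hsinθ : ∀ t, Real.sin (Φ t + Real.pi / 2 + Real.arcsin (x (Φ t)).2) =
      Real.cos (Φ t) * Real.sqrt (1 - (x (Φ t)).2 ^ 2) - Real.sin (Φ t) * (x (Φ t)).2 := by
    intro t
    have a := abs_le.1 (h.abs_snd_le (Φ t))
    rw [add_right_comm, Real.sin_add_pi_div_two, Real.cos_add, Real.cos_arcsin,
      Real.sin_arcsin (by linarith) (by linarith)]
  refine ⟨Φ, T, hmono, hsurj, hΦ0, hT, hT0, ?_, ?_, ?_, ?_, ?_, ?_, ?_, ?_, ?_, ?_⟩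
  · exact Continuous.continuousOn (by fun_prop)
  · exact Continuous.continuousOn (by fun_prop)
  · exact Continuous.continuousOn (by fun_prop)
  · simp [hΦ0, h.zero]
  · simp [hΦ0]
  · simp [hΦ0, h.zero]
  · intro t ht
    have := hsin t ht
    positivity
  · intro t ht
    have hwt := (hw (Φ t)).ne'
    have hexp := (Real.exp_pos (x (Φ t)).1).ne'
    refine ((hdf t ht).mul (hΦd t).cos).congr_deriv ?_
    rw [hcosθ]
    field_simp
    ring
  · intro t ht
    have hwt := (hw (Φ t)).ne'
    have hexp := (Real.exp_pos (x (Φ t)).1).ne'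
    refine ((hdf t ht).mul (hΦd t).sin).congr_deriv ?_
    rw [hsinθ]
    field_simp
    ring
  · intro t ht
    have hwt := (hw (Φ t)).ne'
    have hexp := (Real.exp_pos (x (Φ t)).1).ne'
    have hst := (hsin t ⟨ht.1, ht.2.le⟩).ne'
    have a := abs_le.1 (h.abs_snd_le (Φ t))
    have hsig := (h.deriv_snd _ (hΦI t ht)).comp t (hΦd t)
    have harc := (Real.hasDerivAt_arcsin (x := (x (Φ t)).2) (by linarith) (by linarith)).comp t hsig
    refine (((hΦd t).add_const (Real.pi / 2)).add harc).congr_deriv ?_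
    rw [hcosθ, hsinθ]
    have hexp2 : Real.exp (2 * (x (Φ t)).1) = Real.exp (x (Φ t)).1 ^ 2 := by
      rw [two_mul, Real.exp_add, sq]
    rw [hexp2]
    have hs2 : Real.sqrt 2 ^ 2 = 2 := Real.sq_sqrt (by norm_num)
    have hsc := Real.sin_sq_add_cos_sq (Φ t)
    -- With the transcendental quantities abstracted, the claim is a rational identity modulo `(√2)²
    -- = 2` and `sin² + cos² = 1`.
    generalize Real.sqrt (1 - (x (Φ t)).2 ^ 2) = w at *
    generalize Real.exp (x (Φ t)).1 = E at *
    generalize (x (Φ t)).2 = σ at *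
    generalize Real.sin (Φ t) = S at *
    generalize Real.cos (Φ t) = C at *
    generalize Real.sqrt 2 = q at *
    field_simp
    linear_combination -(E ^ 2 * C * S * (w * C - S * σ) + E ^ 2 * S ^ 2 * (w * S + C * σ)) * hs2 -
      2 * E ^ 2 * S * w * hsc

end IsPolarProfile

/-! ### Hitting a line close to the `r`-axis -/

lemma IsCapOrbit.restrict {c T T' : ℝ} {z r θ : ℝ → ℝ} (h : IsCapOrbit c T z r θ) (h0 : 0 < T')
    (hle : T' ≤ T) : IsCapOrbit c T' z r θ where
  T_pos := h0
  continuousOn_z := h.continuousOn_z.mono (Icc_subset_Icc_right hle)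
  continuousOn_r := h.continuousOn_r.mono (Icc_subset_Icc_right hle)
  continuousOn_θ := h.continuousOn_θ.mono (Icc_subset_Icc_right hle)
  z_zero := h.z_zero
  r_zero := h.r_zero
  θ_zero := h.θ_zero
  r_pos t ht := h.r_pos t ⟨ht.1, ht.2.trans hle⟩
  deriv_z t ht := h.deriv_z t ⟨ht.1, ht.2.trans_le hle⟩
  deriv_r t ht := h.deriv_r t ⟨ht.1, ht.2.trans_le hle⟩
  deriv_θ t ht := h.deriv_θ t ⟨ht.1, ht.2.trans_le hle⟩

lemma sub_le_arcsin_sub_arcsin {a b : ℝ} (ha : |a| ≤ 1 / 100) (hb : |b| ≤ 1 / 100) (hab : a ≤ b) :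
    b - a ≤ Real.arcsin b - Real.arcsin a := by
  rw [abs_le] at ha hb
  have h := Real.abs_sin_sub_sin_le (Real.arcsin b) (Real.arcsin a)
  rw [Real.sin_arcsin (by linarith) (by linarith), Real.sin_arcsin (by linarith) (by linarith),
    abs_of_nonneg (by linarith), abs_of_nonneg (sub_nonneg.2 (Real.monotone_arcsin hab))] at h
  exact h

lemma abs_arcsin_sub_arcsin_le {a b : ℝ} (ha : |a| ≤ 1 / 100) (hb : |b| ≤ 1 / 100) :
    |Real.arcsin b - Real.arcsin a| ≤ 2 * |b - a| := by
  wlog hab : a ≤ b generalizing a b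
  · rw [abs_sub_comm, abs_sub_comm b]
    exact this hb ha (le_of_not_ge hab)
  rw [abs_le] at ha hb
  have h := abs_sub_le_of_hasDerivAt_Ioo (C := 2) hab Real.continuous_arcsin.continuousOn
    (fun t ht => Real.hasDerivAt_arcsin (by linarith [ht.1]) (by linarith [ht.2])) (fun t ht => by
      have h1 : 1 / 2 ≤ Real.sqrt (1 - t ^ 2) := by
        apply Real.le_sqrt_of_sq_le
        nlinarith [ht.1, ht.2]
      rw [abs_of_nonneg (by positivity), div_le_iff₀ (by linarith)]
      linarith)
  rw [abs_of_nonneg (sub_nonneg.2 hab)]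
  linarith

namespace IsPolarProfile

variable {y y' w φ φ' : ℝ} {x x' : ℝ → ℝ × ℝ}

lemma orbitWellDefined (h : IsPolarProfile y x) : OrbitWellDefined (Real.sqrt 2 * Real.exp y) := by
  refine ⟨?_, fun T T' z r θ z' r' θ' h1 h2 => h1.eqOn h2⟩
  obtain ⟨Φ, T, hmono, -, hΦ0, hΦT, horb⟩ := h.exists_isCapOrbit
  refine ⟨T, _, _, _, horb, fun t ht => ?_, by simp [hΦT]⟩
  have h1 : 0 ≤ Φ t := hΦ0 ▸ hmono.monotone ht.1
  have h2 : Φ t < Real.pi / 2 := hΦT ▸ hmono ht.2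
  have := Real.cos_pos_of_mem_Ioo ⟨by linarith [Real.pi_pos], h2⟩
  positivity

/-- The angles at which the orbit hits a line are read off from the polar profile. -/
theorem orbitHitsLine_iff (h : IsPolarProfile y x) {ϑ : ℝ} :
    OrbitHitsLine (Real.sqrt 2 * Real.exp y) w ϑ ↔ ∃ φ ∈ Ioc 0 (Real.pi / 2),
      Real.sqrt 2 * Real.exp (x φ).1 * Real.cos φ = w ∧
        φ + Real.pi / 2 + Real.arcsin (x φ).2 = ϑ := by
  obtain ⟨Φ, T, hmono, hsurj, hΦ0, hΦT, horb⟩ := h.exists_isCapOrbit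
  constructor
  · rintro ⟨T₁, z, r, θ, h1, hz, hw, hθ⟩
    have heq := h1.eqOn horb
    rcases le_or_gt T₁ T with hle | hlt
    · obtain ⟨e1, -, e3⟩ := heq T₁ ⟨h1.T_pos.le, by rw [min_eq_left hle]⟩
      refine ⟨Φ T₁, ⟨hΦ0 ▸ hmono h1.T_pos, hΦT ▸ hmono.monotone hle⟩, ?_, ?_⟩
      · rw [← hw, e1]
      · rw [← hθ, e3]
    -- An orbit continued past `T` would have an interior minimum of `z` at `T`, where `z = 0`; but
    -- there `z' = cos θ = -√(1 - σ²) < 0`.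
    · exfalso
      obtain ⟨e1, -, e3⟩ := heq T ⟨horb.T_pos.le, by rw [min_eq_right hlt.le]⟩
      have hz0 : z T = 0 := by rw [e1, hΦT]; simp
      have hmin : IsLocalMin z T := by
        filter_upwards [Ioo_mem_nhds horb.T_pos hlt] with t ht
        rw [hz0]
        exact hz t ⟨ht.1.le, ht.2.le⟩
      have hd := hmin.hasDerivAt_eq_zero (h1.deriv_z T ⟨horb.T_pos, hlt⟩)
      rw [e3, hΦT, add_halves, add_comm, Real.cos_add_pi, Real.cos_arcsin] at hd
      linarith [(h.sqrt_bounds (Real.pi / 2)).1]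
  · rintro ⟨φ, hφ, hw, hθ⟩
    obtain ⟨T₁, rfl⟩ := hsurj φ
    have h0 : 0 < T₁ := by rw [← hmono.lt_iff_lt, hΦ0]; exact hφ.1
    have hle : T₁ ≤ T := by rw [← hmono.le_iff_le, hΦT]; exact hφ.2
    refine ⟨T₁, _, _, _, horb.restrict h0 hle, fun t ht => ?_, hw, hθ⟩
    have h1 : 0 ≤ Φ t := hΦ0 ▸ hmono.monotone ht.1
    have h2 : Φ t ≤ Real.pi / 2 := hΦT ▸ hmono.monotone (ht.2.trans hle)
    have := Real.cos_nonneg_of_neg_pi_div_two_le_of_le (by linarith [Real.pi_pos]) h2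
    positivity

/-- Since `√2 * exp f ≥ 1`, the equation of the line gives `cos φ ≤ w`, which forces `φ` close to `π
/ 2`. -/
lemma near_equator (h : IsPolarProfile y x) (hw : w ≤ 1 / 100) (hφ : φ ∈ Icc 0 (Real.pi / 2))
    (hz : Real.sqrt 2 * Real.exp (x φ).1 * Real.cos φ = w) :
    Real.cos φ ≤ w ∧ |φ - Real.pi / 2| ≤ 1 / 2 ∧ φ ∈ Icc (Real.pi / 4) (Real.pi / 2) := by
  have hc0 : 0 ≤ Real.cos φ :=
    Real.cos_nonneg_of_neg_pi_div_two_le_of_le (by linarith [Real.pi_pos, hφ.1]) hφ.2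
  have h2 : 1.4 ≤ Real.sqrt 2 := Real.le_sqrt_of_sq_le (by norm_num)
  have hpi := Real.pi_gt_three
  have hpi4 := Real.pi_lt_d2
  have h3 : 1 * Real.cos φ ≤ w := by
    rw [← hz]
    gcongr
    nlinarith [(h.exp_bounds φ).1]
  rw [one_mul] at h3
  have h4 := Real.mul_le_sin (x := Real.pi / 2 - φ) (by linarith [hφ.2]) (by linarith [hφ.1])
  rw [Real.sin_pi_div_two_sub] at h4
  have h5 : 1 / 2 ≤ 2 / Real.pi := by
    rw [div_le_div_iff₀ two_pos Real.pi_pos]; linarith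
  have h6 : 1 / 2 * (Real.pi / 2 - φ) ≤ 2 / Real.pi * (Real.pi / 2 - φ) :=
    mul_le_mul_of_nonneg_right h5 (by linarith [hφ.2])
  refine ⟨h3, ?_, ?_, hφ.2⟩
  · rw [abs_le]
    constructor <;> linarith [hφ.2]
  · linarith

/-- On `[π / 4, π / 2]` the cotangent is at most `1`, and `f`, `σ` are small, so both derivatives
are bounded by `1`. -/
lemma abs_sub_le_near_equator (h : IsPolarProfile y x) (hφ : φ ∈ Icc (Real.pi / 4) (Real.pi / 2))
    (hφ' : φ' ∈ Icc (Real.pi / 4) (Real.pi / 2)) :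
    |(x φ).1 - (x φ').1| ≤ |φ - φ'| ∧ |(x φ).2 - (x φ').2| ≤ |φ - φ'| := by
  wlog hle : φ' ≤ φ generalizing φ φ'
  · rw [abs_sub_comm, abs_sub_comm (x φ).2, abs_sub_comm φ]
    exact this hφ' hφ (le_of_not_ge hle)
  have hpi := Real.pi_pos
  have hI : ∀ t ∈ Ioo φ' φ, t ∈ Ioo 0 (Real.pi / 2) := fun t ht =>
    ⟨by linarith [hφ'.1, ht.1], ht.2.trans_le hφ.2⟩
  rw [abs_of_nonneg (sub_nonneg.2 hle)]
  constructor
  · have := abs_sub_le_of_hasDerivAt_Ioo (C := 1) hle h.continuous.fst.continuousOn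
      (fun t ht => h.deriv_fst t (hI t ht)) (fun t ht => by
        have h1 := (h.sqrt_bounds t).1
        rw [abs_neg, abs_div, abs_of_pos (by linarith : 0 < Real.sqrt (1 - (x t).2 ^ 2)),
          div_le_one (by linarith)]
        linarith [h.abs_snd_le t])
    simpa using this
  · have := abs_sub_le_of_hasDerivAt_Ioo (C := 1) hle h.continuous.snd.continuousOn
      (fun t ht => h.deriv_snd t (hI t ht)) (fun t ht => by
        obtain ⟨h1, h1'⟩ := h.sqrt_bounds t
        obtain ⟨h2, h2'⟩ := h.exp_bounds t
        have hexp2 : Real.exp (2 * (x t).1) = Real.exp (x t).1 ^ 2 := by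
          rw [two_mul, Real.exp_add, sq]
        have htI := hI t ht
        have hs : 0 < Real.sin t :=
          Real.sin_pos_of_pos_of_lt_pi htI.1 (by linarith [htI.2])
        have hcos : 0 ≤ Real.cos t :=
          Real.cos_nonneg_of_neg_pi_div_two_le_of_le (by linarith [htI.1]) htI.2.le
        have hcs : Real.cos t ≤ Real.sin t := by
          rw [← Real.cos_pi_div_two_sub]
          apply Real.cos_le_cos_of_nonneg_of_le_pi <;> linarith [ht.1, hφ'.1, htI.2]
        have hcot : |Real.cos t / Real.sin t| ≤ 1 := by
          rw [abs_of_nonneg (by positivity), div_le_one hs]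
          exact hcs
        have a1 : |Real.sqrt (1 - (x t).2 ^ 2) * (2 * (Real.exp (2 * (x t).1) - 1))| ≤
            1 * (1 / 2) := by
          rw [abs_mul]
          apply mul_le_mul _ _ (abs_nonneg _) one_pos.le
          · rwa [abs_of_pos (by linarith)]
          · rw [hexp2, abs_le]
            constructor <;> nlinarith
        have a2 : |Real.cos t / Real.sin t * (x t).2| ≤ 1 * (1 / 100) := by
          rw [abs_mul]
          exact mul_le_mul hcot (h.abs_snd_le t) (abs_nonneg _) one_pos.le
        refine (abs_sub _ _).trans ?_
        linarith)
    simpa using this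

/-- Two profiles near the equator: the polar angles at which they reach a line close to the
`r`-axis. -/
lemma abs_polarAngle_sub_le (h : IsPolarProfile y x) (h' : IsPolarProfile y' x') {d : ℝ}
    (hd : ∀ φ, ‖x' φ - x φ‖ ≤ d) (hw : w ≤ 1 / 100)
    (hφ : φ ∈ Icc 0 (Real.pi / 2)) (hφ' : φ' ∈ Icc 0 (Real.pi / 2))
    (hz : Real.sqrt 2 * Real.exp (x φ).1 * Real.cos φ = w)
    (hz' : Real.sqrt 2 * Real.exp (x' φ').1 * Real.cos φ' = w) :
    |φ' - φ| ≤ 10 * w * d := by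
  obtain ⟨c1, a1, b1⟩ := h.near_equator hw hφ hz
  obtain ⟨c2, a2, b2⟩ := h'.near_equator hw hφ' hz'
  have h2 : 0 < Real.sqrt 2 := by positivity
  have hc0 : 0 ≤ Real.cos φ' :=
    Real.cos_nonneg_of_neg_pi_div_two_le_of_le (by linarith [Real.pi_pos, hφ'.1]) hφ'.2
  have hw0 : 0 ≤ w := hc0.trans c2
  have hD := abs_sub_le_mul_abs_cos_sub_cos a2 a1
  have hfd : |(x' φ').1 - (x φ).1| ≤ d + |φ' - φ| := by
    have e1 := (h'.abs_sub_le_near_equator b2 b1).1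
    have e2 : |(x' φ).1 - (x φ).1| ≤ d := (norm_fst_le _).trans (hd φ)
    have e3 := abs_add_le ((x' φ').1 - (x' φ).1) ((x' φ).1 - (x φ).1)
    rw [sub_add_sub_cancel] at e3
    linarith
  have hcos : Real.cos φ - Real.cos φ' =
      Real.cos φ' * (Real.exp ((x' φ').1 - (x φ).1) - 1) := by
    have e1 : Real.exp (x φ).1 * Real.cos φ = Real.exp (x' φ').1 * Real.cos φ' := by
      apply mul_left_cancel₀ h2.ne'
      rw [← mul_assoc, ← mul_assoc, hz, hz']
    have e2 := Real.exp_pos (x φ).1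
    rw [Real.exp_sub, mul_sub, mul_one, mul_div_assoc', mul_comm (Real.cos φ'), ← e1,
      mul_div_cancel_left₀ _ e2.ne']
  have hexp : |Real.exp ((x' φ').1 - (x φ).1) - 1| ≤ 2 * |(x' φ').1 - (x φ).1| := by
    apply Real.abs_exp_sub_one_le
    have e1 := abs_le.1 (h.abs_fst_le φ)
    have e2 := abs_le.1 (h'.abs_fst_le φ')
    rw [abs_le]
    constructor <;> linarith [e1.1, e1.2, e2.1, e2.2]
  have hcd : |Real.cos φ' - Real.cos φ| ≤ w * (2 * (d + |φ' - φ|)) := by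
    rw [abs_sub_comm, hcos, abs_mul, abs_of_nonneg hc0]
    apply mul_le_mul c2 _ (abs_nonneg _) hw0
    linarith
  have hd0 : 0 ≤ d := (norm_nonneg _).trans (hd 0)
  -- The estimate so far reads `|φ' - φ| ≤ 8 w (d + |φ' - φ|)`; as `8 w ≤ 8 / 100`, the last term is
  -- absorbed on the left.
  have h8 : 8 * w * |φ' - φ| ≤ 8 * (1 / 100) * |φ' - φ| := by gcongr
  have h9 : 0 ≤ w * d := by positivity
  linarith

end IsPolarProfile

/-! ### The arrival angle as a function of the starting point -/

lemma log_div_sqrt_two_bounds {c c' : ℝ} (hc : 1 ≤ c) (hcc' : c ≤ c') (hc' : c' ≤ 2) :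
    (c' - c) / 2 ≤ Real.log (c' / Real.sqrt 2) - Real.log (c / Real.sqrt 2) ∧
      Real.log (c' / Real.sqrt 2) - Real.log (c / Real.sqrt 2) ≤ c' - c := by
  have h2 : Real.sqrt 2 ≠ 0 := by positivity
  have e : Real.log (c' / Real.sqrt 2) - Real.log (c / Real.sqrt 2) = Real.log (c' / c) := by
    rw [Real.log_div (by linarith) h2, Real.log_div (by linarith) h2,
      Real.log_div (by linarith) (by linarith)]
    ring
  have hc0 : 0 < c := by linarith
  have hc'0 : 0 < c' := by linarith
  rw [e]
  constructor
  · have := Real.one_sub_inv_le_log_of_pos (x := c' / c) (by positivity)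
    refine le_trans ?_ this
    rw [inv_div, one_sub_div hc'0.ne', div_le_div_iff₀ two_pos hc'0]
    nlinarith
  · have := Real.log_le_sub_one_of_pos (x := c' / c) (by positivity)
    refine this.trans ?_
    rw [div_sub_one hc0.ne', div_le_iff₀ hc0]
    nlinarith

/-- For starting points near `√2` and lines near the `r`-axis the angle of arrival is a function of
the starting point, strictly increasing with slope bounded from above and below, uniformly in the
line. -/
theorem exists_arrival_angle :
    ∃ δc > (0 : ℝ), ∃ m > (0 : ℝ), ∃ M : ℝ, ∃ w₀ > (0 : ℝ),
      (∀ c ∈ Ioo (Real.sqrt 2 - δc) (Real.sqrt 2 + δc), OrbitWellDefined c) ∧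
      ∀ w ∈ Ioo 0 w₀, ∃ G : ℝ → ℝ, G (Real.sqrt 2) = Real.pi - Real.arcsin (w / Real.sqrt 2) ∧
        (∀ c ∈ Ioo (Real.sqrt 2 - δc) (Real.sqrt 2 + δc), ∀ ϑ, OrbitHitsLine c w ϑ ↔ G c = ϑ) ∧
        ∀ c ∈ Ioo (Real.sqrt 2 - δc) (Real.sqrt 2 + δc),
          ∀ c' ∈ Ioo (Real.sqrt 2 - δc) (Real.sqrt 2 + δc), c < c' →
            m * (c' - c) ≤ G c' - G c ∧ |G c' - G c| ≤ M * (c' - c) := by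
  obtain ⟨L, hL, κ, hκ, δ, hδ, x, hx, hx0, hxL, hslope⟩ := exists_polarProfile_family
  have h2 : 0 < Real.sqrt 2 := by positivity
  have h2l : 1.4 ≤ Real.sqrt 2 := Real.le_sqrt_of_sq_le (by norm_num)
  have h2u : Real.sqrt 2 ≤ 1.5 := Real.sqrt_le_iff.2 ⟨by norm_num, by norm_num⟩
  set δc := min (1 / 10) δ with hδc
  have hδc1 : δc ≤ 1 / 10 := min_le_left _ _
  have hδcδ : δc ≤ δ := min_le_right _ _
  set I := Ioo (Real.sqrt 2 - δc) (Real.sqrt 2 + δc) with hI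
  set ℓ : ℝ → ℝ := fun c => Real.log (c / Real.sqrt 2) with hℓ
  have hδc0 : 0 < δc := by positivity
  have hI2 : Real.sqrt 2 ∈ I := ⟨by linarith, by linarith⟩
  have hIb : ∀ c ∈ I, 1 ≤ c ∧ c ≤ 2 := fun c hc => ⟨by linarith [hc.1], by linarith [hc.2]⟩
  have hℓ2 : ℓ (Real.sqrt 2) = 0 := by simp [hℓ]
  have hℓb : ∀ c ∈ I, |ℓ c| < δ := fun c hc => by
    rw [abs_lt]
    rcases le_total c (Real.sqrt 2) with hle | hle
    · have := log_div_sqrt_two_bounds (hIb c hc).1 hle (by linarith)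
      change _ ≤ ℓ _ - ℓ _ ∧ ℓ _ - ℓ _ ≤ _ at this
      rw [hℓ2] at this
      constructor <;> linarith [hc.1, hc.2, this.1, this.2]
    · have := log_div_sqrt_two_bounds (by linarith) hle (hIb c hc).2
      change _ ≤ ℓ _ - ℓ _ ∧ ℓ _ - ℓ _ ≤ _ at this
      rw [hℓ2] at this
      constructor <;> linarith [hc.1, hc.2, this.1, this.2]
  have hexp : ∀ c ∈ I, Real.sqrt 2 * Real.exp (ℓ c) = c := fun c hc => by
    have := (hIb c hc).1
    rw [hℓ, Real.exp_log (by positivity)]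
    field_simp
  have hp : ∀ c ∈ I, IsPolarProfile (ℓ c) (x (ℓ c)) := fun c hc => hx _ (hℓb c hc)
  -- The bound `κ / (40 L)` on `w` keeps the variation of the polar angle below `κ / 4` times that
  -- of `log c`. It counts twice, directly and through `σ`, which leaves the slope `κ / 2` in `log
  -- c` and `κ / 4` in `c`.
  refine ⟨δc, hδc0, κ / 4, by positivity, 5 * L, min (1 / 100) (κ / (40 * L)), by positivity,
    fun c hc => hexp c hc ▸ (hp c hc).orbitWellDefined, ?_⟩
  intro w hw
  have hw1 : w ≤ 1 / 100 := (hw.2.trans_le (min_le_left _ _)).le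
  have hwL : 20 * w * L ≤ κ / 2 := by
    have := (hw.2.trans_le (min_le_right _ _)).le
    rw [le_div_iff₀ (by positivity)] at this
    linarith
  have hex : ∀ c, ∃ φ : ℝ, c ∈ I → φ ∈ Icc 0 (Real.pi / 2) ∧
      Real.sqrt 2 * Real.exp (x (ℓ c) φ).1 * Real.cos φ = w := by
    intro c
    by_cases hc : c ∈ I
    · have hcont : ContinuousOn (fun φ => Real.sqrt 2 * Real.exp (x (ℓ c) φ).1 * Real.cos φ)
          (Icc 0 (Real.pi / 2)) := by
        have := (hp c hc).continuous.fst
        exact Continuous.continuousOn (by fun_prop)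
      have := intermediate_value_Icc' (by positivity) hcont
      obtain ⟨φ, hφ, he⟩ := this (show w ∈ Icc _ _ from ⟨by
        simp only [Real.cos_pi_div_two, mul_zero]; exact hw.1.le, by
        simp only [(hp c hc).zero, hexp c hc, Real.cos_zero, mul_one]
        linarith [(hIb c hc).1]⟩)
      exact ⟨φ, fun _ => ⟨hφ, he⟩⟩
    · exact ⟨0, fun h => absurd h hc⟩
  choose P hP using hex
  refine ⟨fun c => P c + Real.pi / 2 + Real.arcsin (x (ℓ c) (P c)).2, ?_, ?_, ?_⟩
  · obtain ⟨hφ, hz⟩ := hP _ hI2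
    simp only [hℓ2, hx0, Prod.fst_zero, Prod.snd_zero, Real.exp_zero, mul_one,
      Real.arcsin_zero] at hz ⊢
    have e1 : Real.cos (P (Real.sqrt 2)) = w / Real.sqrt 2 := by
      rw [eq_div_iff h2.ne', mul_comm, hz]
    have e2 := Real.arccos_cos hφ.1 (by linarith [hφ.2, Real.pi_pos])
    rw [e1, Real.arccos_eq_pi_div_two_sub_arcsin] at e2
    linarith
  · intro c hc ϑ
    obtain ⟨hφ, hz⟩ := hP c hc
    have hiff := (hp c hc).orbitHitsLine_iff (w := w) (ϑ := ϑ)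
    rw [hexp c hc] at hiff
    rw [hiff]
    constructor
    · rintro ⟨φ, hφ', hz', hθ⟩
      -- Comparing a profile with itself, at distance `d = 0`, shows that it meets the line at only
      -- one polar angle.
      have := (hp c hc).abs_polarAngle_sub_le (hp c hc) (d := 0) (by simp) hw1 hφ
        ⟨hφ'.1.le, hφ'.2⟩ hz hz'
      rw [mul_zero, abs_nonpos_iff, sub_eq_zero] at this
      rw [← hθ, this]
    · intro hθ
      have h4 := ((hp c hc).near_equator hw1 hφ hz).2.2.1
      exact ⟨P c, ⟨by linarith [Real.pi_pos], hφ.2⟩, hz, hθ⟩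
  · intro c hc c' hc' hlt
    obtain ⟨hφ, hz⟩ := hP c hc
    obtain ⟨hφ', hz'⟩ := hP c' hc'
    obtain ⟨l1, l2⟩ := log_div_sqrt_two_bounds (hIb c hc).1 hlt.le (hIb c' hc').2
    change _ ≤ ℓ c' - ℓ c at l1
    change ℓ c' - ℓ c ≤ _ at l2
    have hΔ : 0 < ℓ c' - ℓ c := by linarith
    set Δ := ℓ c' - ℓ c with hΔdef
    have hdist : ∀ φ, ‖x (ℓ c') φ - x (ℓ c) φ‖ ≤ L * Δ := fun φ => by
      have := hxL (ℓ c') (ℓ c) φ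
      rwa [abs_of_pos hΔ] at this
    have hD := (hp c hc).abs_polarAngle_sub_le (hp c' hc') hdist hw1 hφ hφ' hz hz'
    have b := ((hp c hc).near_equator hw1 hφ hz).2.2
    have b' := ((hp c' hc').near_equator hw1 hφ' hz').2.2
    have hs := hslope _ _ (hℓb c hc) (hℓb c' hc') (by linarith) (P c) b
    have hσ := (hp c' hc').abs_sub_le_near_equator b' b |>.2
    have hσ2 : |(x (ℓ c') (P c)).2 - (x (ℓ c) (P c)).2| ≤ L * Δ :=
      (norm_snd_le _).trans (hdist _)
    have hDκ : |P c' - P c| ≤ κ / 4 * Δ := by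
      have : 10 * w * L * Δ ≤ κ / 4 * Δ := by gcongr; linarith
      linarith
    have hDL : |P c' - P c| ≤ 1 / 10 * (L * Δ) := by
      have : 10 * w * (L * Δ) ≤ 10 * (1 / 100) * (L * Δ) := by gcongr
      linarith
    have hσl := abs_le.1 hσ
    have hD' := abs_le.1 (le_refl |P c' - P c|)
    have hκΔ : 0 < κ * Δ := by positivity
    have hup : |(x (ℓ c') (P c')).2 - (x (ℓ c) (P c)).2| ≤ |P c' - P c| + L * Δ := by
      have e3 := abs_add_le ((x (ℓ c') (P c')).2 - (x (ℓ c') (P c)).2)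
        ((x (ℓ c') (P c)).2 - (x (ℓ c) (P c)).2)
      rw [sub_add_sub_cancel] at e3
      linarith
    have harc := sub_le_arcsin_sub_arcsin ((hp c hc).abs_snd_le (P c))
      ((hp c' hc').abs_snd_le (P c')) (by linarith [hσl.1])
    have harc2 := abs_arcsin_sub_arcsin_le ((hp c hc).abs_snd_le (P c))
      ((hp c' hc').abs_snd_le (P c'))
    have hLΔ : L * Δ ≤ L * (c' - c) := by gcongr
    constructor
    · have : κ / 4 * (c' - c) ≤ κ / 2 * Δ := by
        have : κ / 2 * ((c' - c) / 2) ≤ κ / 2 * Δ := by gcongr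
        linarith
      linarith [hσl.1, hD'.1]
    · have e : (P c' + Real.pi / 2 + Real.arcsin (x (ℓ c') (P c')).2) -
          (P c + Real.pi / 2 + Real.arcsin (x (ℓ c) (P c)).2) = (P c' - P c) +
            (Real.arcsin (x (ℓ c') (P c')).2 - Real.arcsin (x (ℓ c) (P c)).2) := by ring
      rw [e]
      refine (abs_add_le _ _).trans ?_
      linarith [mul_pos hL hΔ]

/-- A function on an interval about `c₀` whose slopes lie between two positive constants takes every
value close to the central one exactly once, at a point that is controlled by the value. -/
lemma exists_unique_of_slope_bounds {G : ℝ → ℝ} {c₀ δ m M θ : ℝ} (hδ : 0 < δ) (hm : 0 < m)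
    (hG : ∀ c ∈ Ioo (c₀ - δ) (c₀ + δ), ∀ c' ∈ Ioo (c₀ - δ) (c₀ + δ), c < c' →
      m * (c' - c) ≤ G c' - G c ∧ |G c' - G c| ≤ M * (c' - c))
    (hθ : |θ - G c₀| ≤ m * (δ / 2)) :
    ∃ c ∈ Ioo (c₀ - δ) (c₀ + δ), G c = θ ∧ (∀ c' ∈ Ioo (c₀ - δ) (c₀ + δ), G c' = θ → c' = c) ∧
      |c - c₀| ≤ 1 / m * |θ - G c₀| := by
  have h0 : c₀ ∈ Ioo (c₀ - δ) (c₀ + δ) := ⟨by linarith, by linarith⟩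
  have hsub : Icc (c₀ - δ / 2) (c₀ + δ / 2) ⊆ Ioo (c₀ - δ) (c₀ + δ) := fun c hc =>
    ⟨by linarith [hc.1], by linarith [hc.2]⟩
  have habs : ∀ c ∈ Ioo (c₀ - δ) (c₀ + δ), ∀ c' ∈ Ioo (c₀ - δ) (c₀ + δ),
      m * |c' - c| ≤ |G c' - G c| ∧ |G c' - G c| ≤ M * |c' - c| := by
    intro c hc c' hc'
    rcases lt_trichotomy c c' with hlt | rfl | hlt
    · obtain ⟨h1, h2⟩ := hG c hc c' hc' hlt
      rw [abs_of_pos (sub_pos.2 hlt)]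
      exact ⟨h1.trans (le_abs_self _), h2⟩
    · simp
    · obtain ⟨h1, h2⟩ := hG c' hc' c hc hlt
      rw [abs_sub_comm c', abs_sub_comm (G c'), abs_of_pos (sub_pos.2 hlt)]
      exact ⟨h1.trans (le_abs_self _), h2⟩
  have hcont : ContinuousOn G (Icc (c₀ - δ / 2) (c₀ + δ / 2)) := by
    have hlip : LipschitzOnWith (Real.toNNReal M) G (Icc (c₀ - δ / 2) (c₀ + δ / 2)) :=
      LipschitzOnWith.of_dist_le_mul fun c hc c' hc' => by
        rw [Real.dist_eq, Real.dist_eq]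
        refine (habs c' (hsub hc') c (hsub hc)).2.trans ?_
        gcongr
        exact Real.le_coe_toNNReal M
    exact hlip.continuousOn
  have hl := (hG (c₀ - δ / 2) (hsub ⟨le_rfl, by linarith⟩) c₀ h0 (by linarith)).1
  have hr := (hG c₀ h0 (c₀ + δ / 2) (hsub ⟨by linarith, le_rfl⟩) (by linarith)).1
  obtain ⟨hθ1, hθ2⟩ := abs_le.1 hθ
  obtain ⟨c, hc, hcθ⟩ := intermediate_value_Icc (by linarith) hcont
    (show θ ∈ Icc _ _ from ⟨by linarith, by linarith⟩)
  refine ⟨c, hsub hc, hcθ, fun c' hc' hc'θ => ?_, ?_⟩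
  · have := (habs c (hsub hc) c' hc').1
    rw [hcθ, hc'θ, sub_self, abs_zero] at this
    have h1 : |c' - c| ≤ 0 := by
      by_contra h
      nlinarith
    exact sub_eq_zero.1 (abs_nonpos_iff.1 h1)
  · have := (habs c₀ h0 c (hsub hc)).1
    rw [hcθ] at this
    rw [one_div, ← div_eq_inv_mul, le_div_iff₀ hm]
    linarith

theorem mainTheorem7 :
    ∃ δc > (0 : ℝ), ∃ δθ > (0 : ℝ), ∃ C > (0 : ℝ),
      (∀ c ∈ Set.Ioo (Real.sqrt 2 - δc) (Real.sqrt 2 + δc), OrbitWellDefined c) ∧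
      ∀ a > (0 : ℝ), ∃ τ₀ > (0 : ℝ), ∀ τ ∈ Set.Ioo 0 τ₀, ∀ θ₁ : ℝ,
        |θ₁ - (Real.pi - Real.arcsin (τ * a / Real.sqrt 2))| ≤ δθ →
        ∃ c₁ ∈ Set.Ioo (Real.sqrt 2 - δc) (Real.sqrt 2 + δc),
          OrbitHitsLine c₁ (τ * a) θ₁ ∧
          (∀ c ∈ Set.Ioo (Real.sqrt 2 - δc) (Real.sqrt 2 + δc),
            OrbitHitsLine c (τ * a) θ₁ → c = c₁) ∧
          |c₁ - Real.sqrt 2| ≤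
            C * |θ₁ - Real.pi + Real.arcsin (τ * a / Real.sqrt 2)| := by
  obtain ⟨δc, hδc, m, hm, M, w₀, hw₀, hdef, hG⟩ := exists_arrival_angle
  -- Values within `m δc / 2` of the central one are attained on the half-size interval, and `1 / m`
  -- inverts the lower slope bound. Only the threshold `w₀ / a` for `τ` depends on `a`.
  refine ⟨δc, hδc, m * (δc / 2), by positivity, 1 / m, by positivity, hdef, fun a ha => ?_⟩
  refine ⟨w₀ / a, by positivity, fun τ hτ θ₁ hθ₁ => ?_⟩
  obtain ⟨G, hG0, hhit, hslope⟩ := hG (τ * a) ⟨mul_pos hτ.1 ha, (lt_div_iff₀ ha).1 hτ.2⟩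
  rw [← hG0] at hθ₁
  obtain ⟨c₁, hc₁, hGc₁, huniq, hest⟩ := exists_unique_of_slope_bounds hδc hm hslope hθ₁
  refine ⟨c₁, hc₁, (hhit c₁ hc₁ θ₁).2 hGc₁, fun c hc hh => huniq c hc ((hhit c hc θ₁).1 hh), ?_⟩
  rw [hG0] at hest
  rwa [sub_add]
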